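/- Let $(\bar M,J,g)$ be a Kähler manifold, that is, a Riemannian manifold with a smooth endomorphism field $J$ such that $J^2=-\mathrm{Id}$, $g(JU,JV)=g(U,V)$ and $\bar\nabla J=0$ for the Levi-Civita connection $\bar\nabla$ of $g$. Let $(M_T,g_T)$, $(M_\perp,g_\perp)$, $(M_\theta,g_\theta)$ be nonempty Riemannian manifolds with $M_T$ connected, let $f,\sigma:M_T\to(0,\infty)$ be smooth, and let $M=M_T\times_f M_\perp\times_\sigma M_\theta$ be the biwarped product, that is, the product manifold with the metric $g_T+f^2g_\perp+\sigma^2g_\theta$ (pulled back to the product by the projections). Let $\varphi:M\to\bar M$ be a smooth isometric immersion; identify each tangent space $T_pM$ with its image under $d\varphi$, and let $h$ be the second fundamental form of $\varphi$. Let $\mathcal D^T,\mathcal D^\perp,\mathcal D^\theta$ be the distributions on $M$ tangent to the factors $M_T,M_\perp,M_\theta$, so that $TM=\mathcal D^T\oplus\mathcal D^\perp\oplus\mathcal D^\theta$ orthogonally, and assume that $M$ is a generalized $J$-induced submanifold with respect to them: * $J(\mathcal D^T)\subseteq\mathcal D^T$ ($\mathcal D^T$ is holomorphic); * $J(\mathcal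 D^\perp)\subseteq T^\perp M$ ($\mathcal D^\perp$ is totally real); * $\mathcal D^\theta$ is pointwise slant: there is a function $\theta:M\to\mathbb R$ such that for every $p\in M$ and every nonzero $Z\in\mathcal D^\theta_p$ the angle between $JZ$ and $\mathcal D^\theta_p$ equals $\theta(p)$. Assume that $M$ is proper, that is, $\mathcal D^T$, $\mathcal D^\perp$ and $\mathcal D^\theta$ are nonzero and $0<\theta(p)<\pi/2$ for all $p\in M$. Write $FZ$ for the normal part of $JZ$, and assume that the invariant normal subbundle, that is, the orthogonal complement of $J(\mathcal D^\perp)\oplus F(\mathcal D^\theta)$ in the normal bundle $T^\perp M$, is zero. Then $f$ and $\sigma$ are both constant if and only if $M$ is both $(\mathcal D^T,\mathcal D^\perp)$- and $(\mathcal D^T,\mathcal D^\theta)$-mixed geodesic, that is, $h(V,X)=0$ for all $V\in\mathcal D^T$, $X\in\mathcal D^\perp$ and $h(V,Z)=0$ for all $V\in\mathcal D^T$, $Z\in\mathcal D^\theta$. -/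

import Mathlib

open Bundle
open scoped Manifold ContDiff

set_option linter.unusedSectionVars false
namespace KaehlerSubmanifold

noncomputable section LeviCivita

variable {E : Type*} [NormedAddCommGroup E] [NormedSpace ℝ E]
  {M : Type*} [TopologicalSpace M] [ChartedSpace E M] [IsManifold 𝓘(ℝ, E) ∞ M]

/-- For a map `φ : N → M` and a vector field `V` along `φ`, the derivative at `p` of the components
of `V` in the preferred chart of `M` at `φ p`. -/
def componentDeriv {F : Type*} [NormedAddCommGroup F] [NormedSpace ℝ F] {K : Type*}
    [TopologicalSpace K] (I : ModelWithCorners ℝ F K) {N : Type*} [TopologicalSpace N]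
    [ChartedSpace K N] (φ : N → M) (V : ∀ q : N, TangentSpace 𝓘(ℝ, E) (φ q)) (p : N) :
    TangentSpace I p →L[ℝ] TangentSpace 𝓘(ℝ, E) (φ p) :=
  (trivializationAt E (TangentSpace 𝓘(ℝ, E)) (φ p)).symmL ℝ (φ p) ∘L
    mvfderiv I (fun q => (trivializationAt E (TangentSpace 𝓘(ℝ, E)) (φ p) ⟨φ q, V q⟩).2) p

variable (E M) in
/-- The connection on `TM` whose value at each point `x` differentiates the components of a vector
field in the preferred chart at `x`. -/
def chartConnection : CovariantDerivative 𝓘(ℝ, E) E (TangentSpace 𝓘(ℝ, E) : M → Type _) where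
  toFun := componentDeriv 𝓘(ℝ, E) (fun y : M => y)
  isCovariantDerivativeOnUniv :=
    { add := by
        intro Y Y' x hY hY' _
        rw [mdifferentiableAt_section] at hY hY'
        have h : (fun y => (trivializationAt E (TangentSpace 𝓘(ℝ, E)) x ⟨y, (Y + Y') y⟩).2)
            =ᶠ[nhds x] (fun y => (trivializationAt E (TangentSpace 𝓘(ℝ, E)) x ⟨y, Y y⟩).2)
              + fun y => (trivializationAt E (TangentSpace 𝓘(ℝ, E)) x ⟨y, Y' y⟩).2 := by
          filter_upwards [(trivializationAt E (TangentSpace 𝓘(ℝ, E)) x).open_baseSet.mem_nhds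
            (FiberBundle.mem_baseSet_trivializationAt' x)] with y hy
          exact ((trivializationAt E (TangentSpace 𝓘(ℝ, E)) x).linear ℝ hy).map_add _ _
        ext u
        have h3 := congr($(h.mfderiv_eq (I := 𝓘(ℝ, E)) (I' := 𝓘(ℝ, E))) u)
        have h4 := congr($(mvfderiv_add hY hY') u)
        have h2 : mvfderiv 𝓘(ℝ, E)
            (fun y => (trivializationAt E (TangentSpace 𝓘(ℝ, E)) x ⟨y, (Y + Y') y⟩).2) x u =
            mvfderiv 𝓘(ℝ, E)
              (fun y => (trivializationAt E (TangentSpace 𝓘(ℝ, E)) x ⟨y, Y y⟩).2) x u +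
            mvfderiv 𝓘(ℝ, E)
              (fun y => (trivializationAt E (TangentSpace 𝓘(ℝ, E)) x ⟨y, Y' y⟩).2) x u :=
          h3.trans h4
        unfold componentDeriv
        simp only [ContinuousLinearMap.comp_apply, add_apply, h2, map_add]
      leibniz := by
        intro Y g x hY hg _
        rw [mdifferentiableAt_section] at hY
        have h : (fun y => (trivializationAt E (TangentSpace 𝓘(ℝ, E)) x ⟨y, (g • Y) y⟩).2)
            =ᶠ[nhds x] g • (fun y => (trivializationAt E (TangentSpace 𝓘(ℝ, E)) x ⟨y, Y y⟩).2) := by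
          filter_upwards [(trivializationAt E (TangentSpace 𝓘(ℝ, E)) x).open_baseSet.mem_nhds
            (FiberBundle.mem_baseSet_trivializationAt' x)] with y hy
          exact ((trivializationAt E (TangentSpace 𝓘(ℝ, E)) x).linear ℝ hy).map_smul _ _
        ext u
        have h3 := congr($(h.mfderiv_eq (I := 𝓘(ℝ, E)) (I' := 𝓘(ℝ, E))) u)
        have h4 := congr($(mvfderiv_smul hg hY) u)
        have h2 : mvfderiv 𝓘(ℝ, E)
            (fun y => (trivializationAt E (TangentSpace 𝓘(ℝ, E)) x ⟨y, (g • Y) y⟩).2) x u =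
            g x • mvfderiv 𝓘(ℝ, E)
              (fun y => (trivializationAt E (TangentSpace 𝓘(ℝ, E)) x ⟨y, Y y⟩).2) x u +
            mvfderiv 𝓘(ℝ, E) g x u •
              (trivializationAt E (TangentSpace 𝓘(ℝ, E)) x ⟨x, Y x⟩).2 :=
          h3.trans h4
        have h5 : (trivializationAt E (TangentSpace 𝓘(ℝ, E)) x).symmL ℝ x
            (trivializationAt E (TangentSpace 𝓘(ℝ, E)) x ⟨x, Y x⟩).2 = Y x :=
          (Trivialization.symmL_apply _ (FiberBundle.mem_baseSet_trivializationAt' x) _).trans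
            (FiberBundle.extend_apply_self E (Y x))
        unfold componentDeriv
        simp only [ContinuousLinearMap.comp_apply, add_apply, h2, map_add,
          map_smul, h5, smul_apply, ContinuousLinearMap.smulRight_apply] }

variable [FiniteDimensional ℝ E] [RiemannianBundle (fun x : M => TangentSpace 𝓘(ℝ, E) x)]
  [IsContMDiffRiemannianBundle 𝓘(ℝ, E) ∞ E (fun x : M => TangentSpace 𝓘(ℝ, E) x)]

instance (x : M) : FiniteDimensional ℝ (TangentSpace 𝓘(ℝ, E) x) :=
  inferInstanceAs (FiniteDimensional ℝ E)


theorem eventually_extend_add (x : M) (v w : TangentSpace 𝓘(ℝ, E) x) :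
    ∀ᶠ y in nhds x, FiberBundle.extend E (v + w) y =
      FiberBundle.extend E v y + FiberBundle.extend E w y := by
  have hx := FiberBundle.mem_baseSet_trivializationAt' (F := E) (E := TangentSpace 𝓘(ℝ, E)) x
  have h : (trivializationAt E (TangentSpace 𝓘(ℝ, E)) x ⟨x, v + w⟩).2 =
      (trivializationAt E (TangentSpace 𝓘(ℝ, E)) x ⟨x, v⟩).2 +
        (trivializationAt E (TangentSpace 𝓘(ℝ, E)) x ⟨x, w⟩).2 :=
    ((trivializationAt E (TangentSpace 𝓘(ℝ, E)) x).linear ℝ hx).map_add _ _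
  filter_upwards [(trivializationAt E (TangentSpace 𝓘(ℝ, E)) x).open_baseSet.mem_nhds hx]
    with y hy
  unfold FiberBundle.extend
  simp only [h, ← Trivialization.symmₗ_apply (R := ℝ) _ hy, map_add]

theorem eventually_extend_smul (x : M) (c : ℝ) (v : TangentSpace 𝓘(ℝ, E) x) :
    ∀ᶠ y in nhds x, FiberBundle.extend E (c • v) y = c • FiberBundle.extend E v y := by
  have hx := FiberBundle.mem_baseSet_trivializationAt' (F := E) (E := TangentSpace 𝓘(ℝ, E)) x
  have h : (trivializationAt E (TangentSpace 𝓘(ℝ, E)) x ⟨x, c • v⟩).2 =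
      c • (trivializationAt E (TangentSpace 𝓘(ℝ, E)) x ⟨x, v⟩).2 :=
    ((trivializationAt E (TangentSpace 𝓘(ℝ, E)) x).linear ℝ hx).map_smul _ _
  filter_upwards [(trivializationAt E (TangentSpace 𝓘(ℝ, E)) x).open_baseSet.mem_nhds hx]
    with y hy
  unfold FiberBundle.extend
  simp only [h, ← Trivialization.symmₗ_apply (R := ℝ) _ hy, map_smul]

/-- The first partial derivatives `u ↦ ∂_u g(v, w)` at `x` of the metric coefficients in the
preferred chart at `x`: `extend E v` is the vector field which is constant in that chart and has the
value `v` at `x`. -/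
def metricDeriv (x : M) (v w : TangentSpace 𝓘(ℝ, E) x) : TangentSpace 𝓘(ℝ, E) x →L[ℝ] ℝ :=
  mvfderiv 𝓘(ℝ, E)
    (fun y => inner ℝ (FiberBundle.extend E v y) (FiberBundle.extend E w y)) x

theorem mdifferentiableAt_inner_extend (x : M) (v w : TangentSpace 𝓘(ℝ, E) x) :
    MDifferentiableAt 𝓘(ℝ, E) 𝓘(ℝ, ℝ)
      (fun y => inner ℝ (FiberBundle.extend E v y) (FiberBundle.extend E w y)) x :=
  MDifferentiableAt.inner_bundle (IB := 𝓘(ℝ, E)) (F := E)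
    (E := fun y : M => TangentSpace 𝓘(ℝ, E) y) (b := fun y => y)
    (FiberBundle.mdifferentiableAt_extend 𝓘(ℝ, E) E v) (FiberBundle.mdifferentiableAt_extend 𝓘(ℝ, E) E w)


theorem mvfderiv_congr {f f' : M → ℝ} {x : M} (h : f =ᶠ[nhds x] f') :
    mvfderiv 𝓘(ℝ, E) f x = mvfderiv 𝓘(ℝ, E) f' x := by
  ext u
  exact congr($(h.mfderiv_eq (I := 𝓘(ℝ, E)) (I' := 𝓘(ℝ, ℝ))) u)

theorem metricDeriv_add_left (x : M) (v v' w : TangentSpace 𝓘(ℝ, E) x) :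
    metricDeriv x (v + v') w = metricDeriv x v w + metricDeriv x v' w := by
  unfold metricDeriv
  refine Eq.trans (mvfderiv_congr ?_) (mvfderiv_fun_add (mdifferentiableAt_inner_extend x v w)
    (mdifferentiableAt_inner_extend x v' w))
  filter_upwards [eventually_extend_add x v v'] with y hy
  rw [hy, inner_add_left]

theorem metricDeriv_smul_left (x : M) (c : ℝ) (v w : TangentSpace 𝓘(ℝ, E) x) :
    metricDeriv x (c • v) w = c • metricDeriv x v w := by
  unfold metricDeriv
  refine Eq.trans (mvfderiv_congr (f' := fun y =>
    c * inner ℝ (FiberBundle.extend E v y) (FiberBundle.extend E w y)) ?_) ?_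
  · filter_upwards [eventually_extend_smul x c v] with y hy
    rw [hy, real_inner_smul_left]
  · rw [mvfderiv_fun_mul mdifferentiableAt_const (mdifferentiableAt_inner_extend x v w)]
    ext u
    simp [mvfderiv]

theorem metricDeriv_comm (x : M) (v w : TangentSpace 𝓘(ℝ, E) x) :
    metricDeriv x v w = metricDeriv x w v := by
  unfold metricDeriv
  simp only [real_inner_comm]

/-- The Christoffel symbols of the first kind at `x`, in the preferred chart at `x`:
`(∂_u g(v, w) + ∂_v g(w, u) - ∂_w g(u, v)) / 2`. -/
def christoffelForm (x : M) (u v w : TangentSpace 𝓘(ℝ, E) x) : ℝ :=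
  (metricDeriv x v w u + metricDeriv x w u v - metricDeriv x u v w) / 2

theorem metricDeriv_add_right (x : M) (v w w' : TangentSpace 𝓘(ℝ, E) x) :
    metricDeriv x v (w + w') = metricDeriv x v w + metricDeriv x v w' := by
  simp only [metricDeriv_comm x v, metricDeriv_add_left]

theorem metricDeriv_smul_right (x : M) (c : ℝ) (v w : TangentSpace 𝓘(ℝ, E) x) :
    metricDeriv x v (c • w) = c • metricDeriv x v w := by
  simp only [metricDeriv_comm x v, metricDeriv_smul_left]

/-- The Christoffel symbols `Γ(v, u)` of the second kind at `x`, in the preferred chart at `x`: the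
vector whose inner product with every `w` is `christoffelForm x u v w`, expanded in an orthonormal
basis of `T_xM`. -/
def christoffel (x : M) : TangentSpace 𝓘(ℝ, E) x →L[ℝ] TangentSpace 𝓘(ℝ, E) x →L[ℝ]
    TangentSpace 𝓘(ℝ, E) x :=
  LinearMap.toContinuousBilinearMap (LinearMap.mk₂ ℝ
    (fun v u => ∑ i, christoffelForm x u v (stdOrthonormalBasis ℝ (TangentSpace 𝓘(ℝ, E) x) i) •
      stdOrthonormalBasis ℝ (TangentSpace 𝓘(ℝ, E) x) i)
    (by
      intro v v' u
      rw [← Finset.sum_add_distrib]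
      refine Finset.sum_congr rfl fun i _ => ?_
      rw [← add_smul]
      simp only [christoffelForm, metricDeriv_add_left, metricDeriv_add_right, add_apply, map_add]
      congr 1; ring)
    (by
      intro c v u
      rw [Finset.smul_sum]
      refine Finset.sum_congr rfl fun i _ => ?_
      rw [smul_smul]
      simp only [christoffelForm, metricDeriv_smul_left, metricDeriv_smul_right, smul_apply,
        map_smul, smul_eq_mul]
      congr 1; ring)
    (by
      intro v u u'
      rw [← Finset.sum_add_distrib]
      refine Finset.sum_congr rfl fun i _ => ?_
      rw [← add_smul]
      simp only [christoffelForm, metricDeriv_add_left, metricDeriv_add_right, add_apply, map_add]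
      congr 1; ring)
    (by
      intro c v u
      rw [Finset.smul_sum]
      refine Finset.sum_congr rfl fun i _ => ?_
      rw [smul_smul]
      simp only [christoffelForm, metricDeriv_smul_left, metricDeriv_smul_right, smul_apply,
        map_smul, smul_eq_mul]
      congr 1; ring))

/-- `christoffelForm` as a linear map in its last argument. -/
def christoffelFormₗ (x : M) (u v : TangentSpace 𝓘(ℝ, E) x) : TangentSpace 𝓘(ℝ, E) x →ₗ[ℝ] ℝ where
  toFun := christoffelForm x u v
  map_add' w w' := by
    simp only [christoffelForm, metricDeriv_add_left, metricDeriv_add_right, add_apply, map_add]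
    ring
  map_smul' c w := by
    simp only [christoffelForm, metricDeriv_smul_left, metricDeriv_smul_right, smul_apply,
        map_smul, smul_eq_mul, RingHom.id_apply]
    ring

theorem inner_christoffel (x : M) (u v w : TangentSpace 𝓘(ℝ, E) x) :
    inner ℝ (christoffel x v u) w = christoffelForm x u v w := by
  have hform : ∀ w, christoffelForm x u v w = christoffelFormₗ x u v w := fun _ => rfl
  have h1 : christoffel x v u =
      ∑ i, christoffelFormₗ x u v (stdOrthonormalBasis ℝ (TangentSpace 𝓘(ℝ, E) x) i) •
        stdOrthonormalBasis ℝ (TangentSpace 𝓘(ℝ, E) x) i := rfl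
  have h2 := congrArg (christoffelFormₗ x u v)
    ((stdOrthonormalBasis ℝ (TangentSpace 𝓘(ℝ, E) x)).sum_repr' w)
  rw [hform, ← h2, h1, sum_inner, map_sum]
  refine Finset.sum_congr rfl fun i _ => ?_
  rw [real_inner_smul_left, map_smul, smul_eq_mul, mul_comm]

variable (E M) in
/-- The Levi-Civita connection: `∇_u Y = ∂_u Y + Γ(Y, u)` in the preferred chart at each point.
By `leviCivita_torsion` and `leviCivita_metric` it is torsion-free and metric. -/
def leviCivita : CovariantDerivative 𝓘(ℝ, E) E (TangentSpace 𝓘(ℝ, E) : M → Type _) :=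
  (chartConnection E M).addOneForm christoffel


theorem chartConnection_extend (x : M) (v : TangentSpace 𝓘(ℝ, E) x) :
    chartConnection E M (FiberBundle.extend E v) x = 0 := by
  have hx := FiberBundle.mem_baseSet_trivializationAt' (F := E) (E := TangentSpace 𝓘(ℝ, E)) x
  have h : (fun y => (trivializationAt E (TangentSpace 𝓘(ℝ, E)) x
      ⟨y, FiberBundle.extend E v y⟩).2) =ᶠ[nhds x]
      fun _ => (trivializationAt E (TangentSpace 𝓘(ℝ, E)) x ⟨x, v⟩).2 := by
    filter_upwards [(trivializationAt E (TangentSpace 𝓘(ℝ, E)) x).open_baseSet.mem_nhds hx]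
      with y hy
    exact (congrArg Prod.snd (Trivialization.apply_mk_symm
      (trivializationAt E (TangentSpace 𝓘(ℝ, E)) x) hy
      (trivializationAt E (TangentSpace 𝓘(ℝ, E)) x ⟨x, v⟩).2) :)
  ext u
  have h2 := congr($(h.mfderiv_eq (I := 𝓘(ℝ, E)) (I' := 𝓘(ℝ, E))) u)
  have h3 : mvfderiv 𝓘(ℝ, E) (fun y => (trivializationAt E (TangentSpace 𝓘(ℝ, E)) x
      ⟨y, FiberBundle.extend E v y⟩).2) x u = 0 := by
    refine h2.trans ?_
    rw [mfderiv_const]; rfl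
  exact (congrArg ((trivializationAt E (TangentSpace 𝓘(ℝ, E)) x).symmL ℝ x) h3).trans
    (map_zero _)

theorem leviCivita_extend (x : M) (u v : TangentSpace 𝓘(ℝ, E) x) :
    leviCivita E M (FiberBundle.extend E v) x u = christoffel x v u := by
  change (chartConnection E M (FiberBundle.extend E v) x + christoffel x (FiberBundle.extend E v x)) u = _
  rw [chartConnection_extend, FiberBundle.extend_apply_self, zero_add]

theorem lieBracketWithin_of_eventually_const {A B : E → E} {S : Set E} {z a b : E}
    (hA : A =ᶠ[nhds z] fun _ => a) (hB : B =ᶠ[nhds z] fun _ => b) :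
    VectorField.lieBracketWithin ℝ A B S z = 0 := by
  rw [VectorField.lieBracketWithin_eq]
  simp only [(hA.filter_mono nhdsWithin_le_nhds).fderivWithin_eq hA.self_of_nhds,
    (hB.filter_mono nhdsWithin_le_nhds).fderivWithin_eq hB.self_of_nhds]
  simp

theorem mlieBracket_extend (x : M) (u v : TangentSpace 𝓘(ℝ, E) x) :
    VectorField.mlieBracket 𝓘(ℝ, E) (FiberBundle.extend E u) (FiberBundle.extend E v) x = 0 := by
  have key : ∀ w : TangentSpace 𝓘(ℝ, E) x,
     VectorField.mpullbackWithin 𝓘(ℝ, E) 𝓘(ℝ, E) (extChartAt 𝓘(ℝ, E) x).symm (FiberBundle.extend E w)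
       (Set.range 𝓘(ℝ, E)) =ᶠ[nhds (extChartAt 𝓘(ℝ, E) x x)]
     fun _ => (trivializationAt E (TangentSpace 𝓘(ℝ, E)) x ⟨x, w⟩).2 := by
    intro w
    filter_upwards [extChartAt_target_mem_nhds x] with z hz
    have hy := (extChartAt 𝓘(ℝ, E) x).map_target hz
    rw [extChartAt_source] at hy
    have h1 := TangentBundle.symmL_trivializationAt (I := 𝓘(ℝ, E)) hy
    rw [(extChartAt 𝓘(ℝ, E) x).right_inv hz] at h1
    rw [VectorField.mpullbackWithin_apply]
    have h2 : FiberBundle.extend E w ((extChartAt 𝓘(ℝ, E) x).symm z) =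
      mfderivWithin 𝓘(ℝ, E) 𝓘(ℝ, E) (extChartAt 𝓘(ℝ, E) x).symm (Set.range 𝓘(ℝ, E)) z
         (trivializationAt E (TangentSpace 𝓘(ℝ, E)) x ⟨x, w⟩).2 := by
      rw [← h1]
      exact (Trivialization.symmL_apply _ hy _).symm
    rw [h2]
    exact (isInvertible_mfderivWithin_extChartAt_symm hz).inverse_apply_eq.2 rfl
  rw [← VectorField.mlieBracketWithin_univ, VectorField.mlieBracketWithin_apply]
  exact (congrArg _ (lieBracketWithin_of_eventually_const (key u) (key v))).trans (map_zero _)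

theorem christoffel_comm (x : M) (u v : TangentSpace 𝓘(ℝ, E) x) :
    christoffel x v u = christoffel x u v := by
  refine ext_inner_right ℝ fun w => ?_
  rw [inner_christoffel, inner_christoffel, christoffelForm, christoffelForm,
    metricDeriv_comm x v w, metricDeriv_comm x w u, metricDeriv_comm x u v]
  ring

/-- The Levi-Civita connection is torsion-free. -/
theorem leviCivita_torsion : (leviCivita E M).torsion = 0 := by
  ext x u v
  rw [CovariantDerivative.torsion_apply_eq_extend, mlieBracket_extend]
  simp only [FiberBundle.extend_apply_self, leviCivita_extend]
  rw [christoffel_comm, sub_self, sub_zero]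
  rfl

theorem mdifferentiableAt_inner {Y Z : ∀ y : M, TangentSpace 𝓘(ℝ, E) y} {x : M}
    (hY : MDiffAt (T% Y) x) (hZ : MDiffAt (T% Z) x) :
    MDifferentiableAt 𝓘(ℝ, E) 𝓘(ℝ, ℝ) (fun y => inner ℝ (Y y) (Z y)) x :=
  MDifferentiableAt.inner_bundle (IB := 𝓘(ℝ, E)) (F := E)
    (E := fun y : M => TangentSpace 𝓘(ℝ, E) y) (b := fun y => y) hY hZ

/-- `(∇_u g)(Y, Z) = u g(Y, Z) - g(∇_u Y, Z) - g(Y, ∇_u Z)`. -/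
def metricDefect (x : M) (u : TangentSpace 𝓘(ℝ, E) x)
    (Y Z : ∀ y : M, TangentSpace 𝓘(ℝ, E) y) : ℝ :=
  mvfderiv 𝓘(ℝ, E) (fun y => inner ℝ (Y y) (Z y)) x u -
    (inner ℝ (leviCivita E M Y x u) (Z x) + inner ℝ (Y x) (leviCivita E M Z x u))

theorem metricDefect_comm (x : M) (u : TangentSpace 𝓘(ℝ, E) x)
    (Y Z : ∀ y : M, TangentSpace 𝓘(ℝ, E) y) : metricDefect x u Y Z = metricDefect x u Z Y := by
  unfold metricDefect
  simp only [real_inner_comm]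
  ring

theorem metricDefect_tensorial (x : M) (u : TangentSpace 𝓘(ℝ, E) x)
    {Z : ∀ y : M, TangentSpace 𝓘(ℝ, E) y} (hZ : MDiffAt (T% Z) x) :
    TensorialAt 𝓘(ℝ, E) E (fun Y : ∀ y : M, TangentSpace 𝓘(ℝ, E) y => metricDefect x u Y Z) x where
  smul := by
    intro f Y hf hY
    have h1 := (leviCivita E M).isCovariantDerivativeOnUniv.leibniz hY hf
    have h2 : (fun y => inner ℝ ((f • Y) y) (Z y)) = fun y => f y * inner ℝ (Y y) (Z y) :=
      funext fun y => real_inner_smul_left _ _ _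
    have h3 := congr($(mvfderiv_fun_mul hf (mdifferentiableAt_inner hY hZ)) u)
    unfold metricDefect
    rw [h2, h3, h1]
    change _ - (inner ℝ (f x • leviCivita E M Y x u + mvfderiv 𝓘(ℝ, E) f x u • Y x) (Z x) +
      inner ℝ (f x • Y x) _) = _
    simp only [inner_add_left, real_inner_smul_left, smul_eq_mul, add_apply, smul_apply]
    ring
  add := by
    intro Y Y' hY hY'
    have h1 := (leviCivita E M).isCovariantDerivativeOnUniv.add hY hY'
    have h2 : (fun y => inner ℝ ((Y + Y') y) (Z y)) =
        fun y => inner ℝ (Y y) (Z y) + inner ℝ (Y' y) (Z y) :=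
      funext fun y => inner_add_left _ _ _
    have h3 := congr($(mvfderiv_fun_add (mdifferentiableAt_inner hY hZ)
      (mdifferentiableAt_inner hY' hZ)) u)
    unfold metricDefect
    rw [h2, h3, h1]
    change _ - (inner ℝ (leviCivita E M Y x u + leviCivita E M Y' x u) (Z x) +
      inner ℝ (Y x + Y' x) _) = _
    simp only [inner_add_left, add_apply]
    ring

/-- The Levi-Civita connection is compatible with the metric. -/
theorem leviCivita_metric {Y Z : ∀ y : M, TangentSpace 𝓘(ℝ, E) y} {x : M}
    (hY : MDiffAt (T% Y) x) (hZ : MDiffAt (T% Z) x) (u : TangentSpace 𝓘(ℝ, E) x) :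
    mvfderiv 𝓘(ℝ, E) (fun y => inner ℝ (Y y) (Z y)) x u =
      inner ℝ (leviCivita E M Y x u) (Z x) + inner ℝ (Y x) (leviCivita E M Z x u) := by
  have h1 := (metricDefect_tensorial x u hZ).pointwise hY
    (FiberBundle.mdifferentiableAt_extend 𝓘(ℝ, E) E (Y x)) (FiberBundle.extend_apply_self E (Y x)).symm
  have h2 := (metricDefect_tensorial x u
    (FiberBundle.mdifferentiableAt_extend 𝓘(ℝ, E) E (Y x))).pointwise hZ
    (FiberBundle.mdifferentiableAt_extend 𝓘(ℝ, E) E (Z x)) (FiberBundle.extend_apply_self E (Z x)).symm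
  rw [metricDefect_comm x u Z, metricDefect_comm x u (FiberBundle.extend E (Z x))] at h2
  have h3 : metricDefect x u (FiberBundle.extend E (Y x)) (FiberBundle.extend E (Z x)) = 0 := by
    unfold metricDefect
    rw [FiberBundle.extend_apply_self, FiberBundle.extend_apply_self, leviCivita_extend,
      leviCivita_extend, real_inner_comm _ (Y x), inner_christoffel, inner_christoffel]
    change metricDeriv x (Y x) (Z x) u - _ = 0
    unfold christoffelForm
    rw [metricDeriv_comm x (Z x) (Y x), metricDeriv_comm x (Z x) u, metricDeriv_comm x u (Y x)]
    ring
  have h4 : metricDefect x u Y Z = 0 := h1.trans (h2.trans h3)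
  unfold metricDefect at h4
  linarith
end LeviCivita

noncomputable section Submanifold

variable {E : Type*} [NormedAddCommGroup E] [NormedSpace ℝ E] [FiniteDimensional ℝ E]
  {M : Type*} [TopologicalSpace M] [ChartedSpace E M] [IsManifold 𝓘(ℝ, E) ∞ M]
  [RiemannianBundle (fun x : M => TangentSpace 𝓘(ℝ, E) x)]
  [IsContMDiffRiemannianBundle 𝓘(ℝ, E) ∞ E (fun x : M => TangentSpace 𝓘(ℝ, E) x)]

/-- A Kähler structure on the Riemannian manifold `M`: a smooth almost complex structure `J` which
is orthogonal for the metric and parallel for the Levi-Civita connection, that is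
`∇_u (J Y) = J (∇_u Y)`. -/
structure IsKaehler (J : ∀ x : M, TangentSpace 𝓘(ℝ, E) x →L[ℝ] TangentSpace 𝓘(ℝ, E) x) :
    Prop where
  contMDiff : ContMDiff 𝓘(ℝ, E) (𝓘(ℝ, E).prod 𝓘(ℝ, E →L[ℝ] E)) ∞
    (fun x => (TotalSpace.mk' (E →L[ℝ] E) x (J x) : TotalSpace (E →L[ℝ] E)
      (fun x : M => TangentSpace 𝓘(ℝ, E) x →L[ℝ] TangentSpace 𝓘(ℝ, E) x)))
  sq : ∀ (x : M) (v : TangentSpace 𝓘(ℝ, E) x), J x (J x v) = -v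
  inner_map : ∀ (x : M) (v w : TangentSpace 𝓘(ℝ, E) x),
    inner ℝ (J x v) (J x w) = inner ℝ v w
  parallel : ∀ (Y : ∀ y : M, TangentSpace 𝓘(ℝ, E) y) (x : M), MDiffAt (T% Y) x →
    ∀ u : TangentSpace 𝓘(ℝ, E) x,
      leviCivita E M (fun y => J y (Y y)) x u = J x (leviCivita E M Y x u)

variable {F : Type*} [NormedAddCommGroup F] [NormedSpace ℝ F] {K : Type*} [TopologicalSpace K]
  (I : ModelWithCorners ℝ F K) {N : Type*} [TopologicalSpace N] [ChartedSpace K N]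

/-- The covariant derivative `∇_u V` at `p`, in direction `u ∈ T_pN`, of a vector field `V` along
the map `φ : N → M`, for the Levi-Civita connection of `M`: in components,
`(∇_u V)^k = u(V^k) + Γ^k_{ij} (dφ u)^i V^j`. -/
def covDerivAlong (φ : N → M) (V : ∀ q : N, TangentSpace 𝓘(ℝ, E) (φ q)) (p : N)
    (u : TangentSpace I p) : TangentSpace 𝓘(ℝ, E) (φ p) :=
  componentDeriv I φ V p u + christoffel (φ p) (V p) (mfderiv I 𝓘(ℝ, E) φ p u)

/-- For the restriction to `φ` of a vector field `Y` of `M` this is `∇_{dφ u} Y`. -/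
theorem covDerivAlong_comp {φ : N → M} {p : N} (hφ : MDifferentiableAt I 𝓘(ℝ, E) φ p)
    {Y : ∀ y : M, TangentSpace 𝓘(ℝ, E) y} (hY : MDiffAt (T% Y) (φ p)) (u : TangentSpace I p) :
    covDerivAlong I φ (fun q => Y (φ q)) p u =
      leviCivita E M Y (φ p) (mfderiv I 𝓘(ℝ, E) φ p u) := by
  rw [mdifferentiableAt_section] at hY
  have h := congr($(mfderiv_comp p hY hφ) u)
  exact congrArg (fun w => (trivializationAt E (TangentSpace 𝓘(ℝ, E)) (φ p)).symmL ℝ (φ p) w +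
    christoffel (φ p) (Y (φ p)) (mfderiv I 𝓘(ℝ, E) φ p u)) h

/-- The image `dφ(T_pN)`. -/
def tangentPlane (φ : N → M) (p : N) : Submodule ℝ (TangentSpace 𝓘(ℝ, E) (φ p)) :=
  (mfderiv I 𝓘(ℝ, E) φ p).range

/-- Orthogonal projection onto the normal space `(dφ(T_pN))ᗮ`. -/
def normalPart (φ : N → M) (p : N) :
    TangentSpace 𝓘(ℝ, E) (φ p) →L[ℝ] TangentSpace 𝓘(ℝ, E) (φ p) :=
  (tangentPlane I φ p)ᗮ.starProjection

/-- The second fundamental form `h(u, v)` at `p` of an immersion `φ`: the normal part of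
`∇_u (dφ V)`, where `V = extend F v` is a vector field on `N` with `V p = v`. -/
def secondFundamentalForm [IsManifold I 1 N] (φ : N → M) (p : N) (u v : TangentSpace I p) :
    TangentSpace 𝓘(ℝ, E) (φ p) :=
  normalPart I φ p
    (covDerivAlong I φ (fun q => mfderiv I 𝓘(ℝ, E) φ q (FiberBundle.extend F v q)) p u)

/-- `φ` is `(D₁, D₂)`-mixed geodesic: `h(u, v) = 0` for all `u ∈ D₁` and `v ∈ D₂`. -/
def IsMixedGeodesic [IsManifold I 1 N] (φ : N → M)
    (D₁ D₂ : ∀ p : N, Submodule ℝ (TangentSpace I p)) : Prop :=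
  ∀ p, ∀ u ∈ D₁ p, ∀ v ∈ D₂ p,
    (secondFundamentalForm I φ p u v : TangentSpace 𝓘(ℝ, E) (φ p)) = 0

end Submanifold

noncomputable section Biwarped

variable {ET : Type*} [NormedAddCommGroup ET] [NormedSpace ℝ ET]
  {EP : Type*} [NormedAddCommGroup EP] [NormedSpace ℝ EP]
  {ES : Type*} [NormedAddCommGroup ES] [NormedSpace ℝ ES]
  {MT : Type*} [TopologicalSpace MT] [ChartedSpace ET MT]
  {MP : Type*} [TopologicalSpace MP] [ChartedSpace EP MP]
  {MS : Type*} [TopologicalSpace MS] [ChartedSpace ES MS]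

variable (ET EP ES) in
/-- The model with corners of a product of three manifolds without boundary. -/
abbrev prodModel : ModelWithCorners ℝ (ET × EP × ES) (ModelProd ET (ModelProd EP ES)) :=
  𝓘(ℝ, ET).prod (𝓘(ℝ, EP).prod 𝓘(ℝ, ES))

/-- The differential of the projection `MT × MP × MS → MT`. -/
def dprojT (p : MT × MP × MS) :
    TangentSpace (prodModel ET EP ES) p →L[ℝ] TangentSpace 𝓘(ℝ, ET) p.1 :=
  mfderiv (prodModel ET EP ES) 𝓘(ℝ, ET) (fun q : MT × MP × MS => q.1) p

/-- The differential of the projection `MT × MP × MS → MP`. -/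
def dprojP (p : MT × MP × MS) :
    TangentSpace (prodModel ET EP ES) p →L[ℝ] TangentSpace 𝓘(ℝ, EP) p.2.1 :=
  mfderiv (prodModel ET EP ES) 𝓘(ℝ, EP) (fun q : MT × MP × MS => q.2.1) p

/-- The differential of the projection `MT × MP × MS → MS`. -/
def dprojS (p : MT × MP × MS) :
    TangentSpace (prodModel ET EP ES) p →L[ℝ] TangentSpace 𝓘(ℝ, ES) p.2.2 :=
  mfderiv (prodModel ET EP ES) 𝓘(ℝ, ES) (fun q : MT × MP × MS => q.2.2) p

variable (ET EP ES) in
/-- The vectors of `T_p(MT × MP × MS)` tangent to the factor `MT`. -/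
def distT (p : MT × MP × MS) : Submodule ℝ (TangentSpace (prodModel ET EP ES) p) :=
  (dprojP p).ker ⊓ (dprojS p).ker

variable (ET EP ES) in
/-- The vectors of `T_p(MT × MP × MS)` tangent to the factor `MP`. -/
def distP (p : MT × MP × MS) : Submodule ℝ (TangentSpace (prodModel ET EP ES) p) :=
  (dprojT p).ker ⊓ (dprojS p).ker

variable (ET EP ES) in
/-- The vectors of `T_p(MT × MP × MS)` tangent to the factor `MS`. -/
def distS (p : MT × MP × MS) : Submodule ℝ (TangentSpace (prodModel ET EP ES) p) :=
  (dprojT p).ker ⊓ (dprojP p).ker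

/-- The biwarped product metric `g_T + f² g_P + σ² g_S` on `MT × MP × MS`. -/
def biwarpedMetric
    [RiemannianBundle (fun x : MT => TangentSpace 𝓘(ℝ, ET) x)]
    [RiemannianBundle (fun x : MP => TangentSpace 𝓘(ℝ, EP) x)]
    [RiemannianBundle (fun x : MS => TangentSpace 𝓘(ℝ, ES) x)]
    (f σ : MT → ℝ) (p : MT × MP × MS) (u v : TangentSpace (prodModel ET EP ES) p) : ℝ :=
  inner ℝ (dprojT p u) (dprojT p v) + f p.1 ^ 2 * inner ℝ (dprojP p u) (dprojP p v) +
    σ p.1 ^ 2 * inner ℝ (dprojS p u) (dprojS p v)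

variable {E : Type*} [NormedAddCommGroup E] [NormedSpace ℝ E]
  {M : Type*} [TopologicalSpace M] [ChartedSpace E M]

/-- The image under `dφ` of a distribution `D` on `MT × MP × MS`. -/
def imageDist (φ : MT × MP × MS → M)
    (D : ∀ p : MT × MP × MS, Submodule ℝ (TangentSpace (prodModel ET EP ES) p))
    (p : MT × MP × MS) : Submodule ℝ (TangentSpace 𝓘(ℝ, E) (φ p)) :=
  (D p).map (mfderiv (prodModel ET EP ES) 𝓘(ℝ, E) φ p).toLinearMap

variable [FiniteDimensional ℝ E] [RiemannianBundle (fun x : M => TangentSpace 𝓘(ℝ, E) x)]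

variable (ET EP ES E) in
/-- `φ` immerses the biwarped product `MT ×_f MP ×_σ MS` isometrically into `M`. -/
structure IsBiwarpedSubmanifold
    [RiemannianBundle (fun x : MT => TangentSpace 𝓘(ℝ, ET) x)]
    [RiemannianBundle (fun x : MP => TangentSpace 𝓘(ℝ, EP) x)]
    [RiemannianBundle (fun x : MS => TangentSpace 𝓘(ℝ, ES) x)]
    (f σ : MT → ℝ) (φ : MT × MP × MS → M) : Prop where
  contMDiff_f : ContMDiff 𝓘(ℝ, ET) 𝓘(ℝ, ℝ) ∞ f
  f_pos : ∀ x, 0 < f x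
  contMDiff_σ : ContMDiff 𝓘(ℝ, ET) 𝓘(ℝ, ℝ) ∞ σ
  σ_pos : ∀ x, 0 < σ x
  contMDiff_φ : ContMDiff (prodModel ET EP ES) 𝓘(ℝ, E) ∞ φ
  isometric : ∀ (p : MT × MP × MS) (u v : TangentSpace (prodModel ET EP ES) p),
    inner ℝ (mfderiv (prodModel ET EP ES) 𝓘(ℝ, E) φ p u)
      (mfderiv (prodModel ET EP ES) 𝓘(ℝ, E) φ p v) = biwarpedMetric f σ p u v

/-- The angle between a vector `w` and a linear subspace `W`, that is, between `w` and its
orthogonal projection onto `W` (it is `π / 2` when `w` is orthogonal to `W`). -/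
def angleToSubspace {x : M} (w : TangentSpace 𝓘(ℝ, E) x)
    (W : Submodule ℝ (TangentSpace 𝓘(ℝ, E) x)) : ℝ :=
  InnerProductGeometry.angle w (W.starProjection w)

variable (ET EP ES) in
/-- The submanifold `φ : MT × MP × MS → M` is a generalized `J`-induced submanifold of order 1 whose
holomorphic, totally real and pointwise slant distributions are those tangent to the factors `MT`,
`MP` and `MS`; the slant function is `θ`. (For the biwarped product metric the tangent bundle is the
orthogonal direct sum of these three distributions.) -/
structure IsGeneralizedJInduced
    (J : ∀ x : M, TangentSpace 𝓘(ℝ, E) x →L[ℝ] TangentSpace 𝓘(ℝ, E) x)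
    (φ : MT × MP × MS → M) (θ : MT × MP × MS → ℝ) : Prop where
  holomorphic : ∀ p, ∀ w ∈ imageDist φ (distT ET EP ES) p,
    J (φ p) w ∈ imageDist φ (distT ET EP ES) p
  totallyReal : ∀ p, ∀ w ∈ imageDist φ (distP ET EP ES) p,
    J (φ p) w ∈ (tangentPlane (prodModel ET EP ES) φ p)ᗮ
  slant : ∀ p, ∀ w ∈ imageDist φ (distS ET EP ES) p, w ≠ 0 →
    angleToSubspace (J (φ p) w) (imageDist φ (distS ET EP ES) p) = θ p

variable (ET EP ES) in
/-- The three distributions are nonzero and the slant function takes values in `(0, π / 2)`. -/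
structure IsProper (θ : MT × MP × MS → ℝ) : Prop where
  distT_ne : ∀ p : MT × MP × MS, distT ET EP ES p ≠ ⊥
  distP_ne : ∀ p : MT × MP × MS, distP ET EP ES p ≠ ⊥
  distS_ne : ∀ p : MT × MP × MS, distS ET EP ES p ≠ ⊥
  slant_mem : ∀ p, θ p ∈ Set.Ioo 0 (Real.pi / 2)

variable (ET EP ES) in
/-- The invariant normal subbundle: the orthogonal complement, in the normal space at `p`, of
`J(D^⊥) ⊕ F(D^θ)`, where `F w` is the normal part of `J w`. -/
def invariantNormal (J : ∀ x : M, TangentSpace 𝓘(ℝ, E) x →L[ℝ] TangentSpace 𝓘(ℝ, E) x)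
    (φ : MT × MP × MS → M) (p : MT × MP × MS) : Submodule ℝ (TangentSpace 𝓘(ℝ, E) (φ p)) :=
  ((imageDist φ (distP ET EP ES) p).map (J (φ p)).toLinearMap ⊔
    (imageDist φ (distS ET EP ES) p).map
      (normalPart (prodModel ET EP ES) φ p ∘L J (φ p)).toLinearMap)ᗮ ⊓
    (tangentPlane (prodModel ET EP ES) φ p)ᗮ

end Biwarped

end KaehlerSubmanifold

namespace KaehlerSubmanifold


/-! ### Calculus of vector-valued functions on a manifold. -/

section VectorValued

variable {F : Type*} [NormedAddCommGroup F] [NormedSpace ℝ F] {K : Type*}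
  [TopologicalSpace K] {I : ModelWithCorners ℝ F K} {N : Type*} [TopologicalSpace N]
  [ChartedSpace K N] {V W : Type*} [NormedAddCommGroup V] [NormedSpace ℝ V]
  [NormedAddCommGroup W] [NormedSpace ℝ W]

/-! Everything follows from one formula for the second fundamental form. Let `u` lie in `D^T` with
`J u = u'`, let `a` and `b` be tangent to `MP × MS`, and split `J b` into its tangential part `c`
and normal part `F b`. Then `⟨h(u, a), F b⟩ = -½ u'⟨a, b⟩ - ½ u⟨a, c⟩`, where vectors are extended
by fields constant in a chart. Indeed `⟨h(u, a), F b⟩ = ⟨∇_u a, J b⟩ - ⟨∇_u a, c⟩`. The second term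
is given by the Koszul formula, since brackets vanish and `u` is orthogonal to `a` and `c` near the
point. For the first, symmetry and `∇J = 0` give `⟨∇_u a, J b⟩ = -⟨∇_a (J u), b⟩`, and orthogonality
of `J u` and of `u'` to `b` replaces this by `-⟨∇_{u'} a, b⟩`, again a Koszul term.

For the biwarped metric these derivatives fall only on the warping functions, so the formula is
linear in `df` and `dσ` (`IsGeneralizedJInduced.inner_secondFundamentalForm`). If both functions are
constant, `h(u, a)` is orthogonal to every `F b`; as the invariant normal subbundle is zero, `h(u,
a) = 0`.

Conversely, put `b = a`. For `a` in `D^⊥` the tangential part `c` is zero; for `a` in `D^θ` it is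
orthogonal to `a`, because `⟨a, J a⟩ = 0`. In both cases only `-f df(J u) |a|²` or `-σ dσ(J u) |a|²`
is left, with norms taken in the unwarped factor. Since `J` maps `D^T` onto itself, the differential
vanishes, and connectedness of `MT` concludes.

The analytic preparation consists of three facts about differentiation along a map: the Hessian is
symmetric (`covDerivAlong_mfderiv_extend_comm`), `J` is parallel (`IsKaehler.covDerivAlong_map`) and
the metric is parallel (`mvfderiv_inner_along`). -/

theorem mvfderiv_congr_of_eventuallyEq {a b : N → V} {p : N} (h : a =ᶠ[nhds p] b)
    (u : TangentSpace I p) : mvfderiv I a p u = mvfderiv I b p u :=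
  congr($(h.mfderiv_eq (I := I) (I' := 𝓘(ℝ, V))) u)

theorem mvfderiv_eq_zero_of_eventuallyEq {a : N → V} {p : N} {c : V} (h : ∀ᶠ q in nhds p, a q = c)
    (u : TangentSpace I p) : mvfderiv I a p u = 0 := by
  rw [mvfderiv_congr_of_eventuallyEq (b := fun _ => c) h, mvfderiv_const]
  rfl

/-- The product rule in the form needed below, where `A` is the coordinate matrix of `J` or of the
metric and `a` the components of a field along a map. -/
theorem mvfderiv_clm_apply {A : N → V →L[ℝ] W} {a : N → V} {p : N}
    (hA : MDifferentiableAt I 𝓘(ℝ, V →L[ℝ] W) A p) (ha : MDifferentiableAt I 𝓘(ℝ, V) a p)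
    (u : TangentSpace I p) :
    mvfderiv I (fun q => A q (a q)) p u = mvfderiv I A p u (a p) + A p (mvfderiv I a p u) := by
  let A' : F →L[ℝ] V →L[ℝ] W := mfderiv I 𝓘(ℝ, V →L[ℝ] W) A p
  let a' : F →L[ℝ] V := mfderiv I 𝓘(ℝ, V) a p
  let D : F →L[ℝ] W := A'.flip (a p) + A p ∘L a'
  have h : HasMFDerivAt I 𝓘(ℝ, W) (fun q => A q (a q)) p D := by
    refine ⟨(hA.clm_apply ha).continuousAt, ?_⟩
    have h1 := hA.hasMFDerivAt.2.clm_apply ha.hasMFDerivAt.2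
    simp only [writtenInExtChartAt, Function.comp_apply, mfld_simps] at h1 ⊢
    rw [show D = A p ∘L a' + A'.flip (a p) from add_comm _ _]
    exact h1
  exact congr($(h.mfderiv) u)

theorem mvfderiv_comp_map {E : Type*} [NormedAddCommGroup E] [NormedSpace ℝ E]
    {M : Type*} [TopologicalSpace M] [ChartedSpace E M] {g : M → V} {φ : N → M} {p : N}
    (hg : MDifferentiableAt 𝓘(ℝ, E) 𝓘(ℝ, V) g (φ p)) (hφ : MDifferentiableAt I 𝓘(ℝ, E) φ p)
    (u : TangentSpace I p) :
    mvfderiv I (fun q => g (φ q)) p u =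
      mvfderiv 𝓘(ℝ, E) g (φ p) (mfderiv I 𝓘(ℝ, E) φ p u) :=
  mfderiv_comp_apply p hg hφ u

end VectorValued

/-! ### Coordinates of the image under `dφ` of a field constant in a chart. -/

section Extend

variable {E : Type*} [NormedAddCommGroup E] [NormedSpace ℝ E]
  {M : Type*} [TopologicalSpace M] [ChartedSpace E M] [IsManifold 𝓘(ℝ, E) ∞ M]
  {F : Type*} [NormedAddCommGroup F] [NormedSpace ℝ F] {K : Type*}
  [TopologicalSpace K] {I : ModelWithCorners ℝ F K} [I.Boundaryless] {N : Type*}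
  [TopologicalSpace N] [ChartedSpace K N] [IsManifold I 1 N]

/-- In charts, the image under `dφ` of the vector field `extend F v`, which is constant in the chart
at `p`, is the derivative of the coordinate expression of `φ` in a fixed direction. -/
theorem eventually_trivialization_mfderiv_extend {φ : N → M} {p : N}
    (hφ : ∀ᶠ q in nhds p, MDifferentiableAt I 𝓘(ℝ, E) φ q) (v : TangentSpace I p) :
    ∀ᶠ q in nhds p, (trivializationAt E (TangentSpace 𝓘(ℝ, E)) (φ p)
        ⟨φ q, mfderiv I 𝓘(ℝ, E) φ q (FiberBundle.extend F v q)⟩).2 =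
      fderiv ℝ (writtenInExtChartAt I 𝓘(ℝ, E) p φ) (extChartAt I p q)
        (trivializationAt F (TangentSpace I) p ⟨p, v⟩).2 := by
  have hc : ContinuousAt φ p := hφ.self_of_nhds.continuousAt
  filter_upwards [hφ, (chartAt K p).open_source.mem_nhds (mem_chart_source K p),
    hc ((chartAt E (φ p)).open_source.mem_nhds (mem_chart_source E (φ p)))] with q h1 h2 h3
  replace h3 : φ q ∈ (chartAt E (φ p)).source := h3
  have h2' : q ∈ (extChartAt I p).source := by rwa [extChartAt_source]
  have e1 : FiberBundle.extend F v q = (trivializationAt F (TangentSpace I) p).symmL ℝ q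
      (trivializationAt F (TangentSpace I) p ⟨p, v⟩).2 :=
    (Trivialization.symmL_apply _ h2 _).symm
  have e2 := TangentBundle.continuousLinearMapAt_trivializationAt (𝕜 := ℝ) (I := 𝓘(ℝ, E)) h3
  have e3 := TangentBundle.symmL_trivializationAt (𝕜 := ℝ) (I := I) h2
  have e4 : ∀ w : TangentSpace 𝓘(ℝ, E) (φ q), (trivializationAt E (TangentSpace 𝓘(ℝ, E)) (φ p)
      ⟨φ q, w⟩).2 = (trivializationAt E (TangentSpace 𝓘(ℝ, E)) (φ p)).continuousLinearMapAt ℝ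
        (φ q) w := fun w =>
    (Trivialization.continuousLinearMapAt_apply_of_mem ℝ _ h3 w).symm
  rw [e4, e1, e2, e3]
  -- Without boundary the inverse chart has an honest derivative, so the chain rule applies to chart
  -- ∘ `φ` ∘ inverse chart.
  rw [I.range_eq_univ, mfderivWithin_univ]
  have d1 : MDifferentiableAt 𝓘(ℝ, F) I (extChartAt I p).symm (extChartAt I p q) := by
    have := mdifferentiableWithinAt_extChartAt_symm (I := I) ((extChartAt I p).map_source h2')
    rwa [I.range_eq_univ, mdifferentiableWithinAt_univ] at this
  have d0 : (extChartAt I p).symm (extChartAt I p q) = q := (extChartAt I p).left_inv h2'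
  have d2 : MDifferentiableAt I 𝓘(ℝ, E) φ ((extChartAt I p).symm (extChartAt I p q)) := by
    rwa [d0]
  have d3 : MDifferentiableAt 𝓘(ℝ, E) 𝓘(ℝ, E) (extChartAt 𝓘(ℝ, E) (φ p))
      (φ ((extChartAt I p).symm (extChartAt I p q))) := by
    rw [d0]; exact mdifferentiableAt_extChartAt h3
  have c1 := mfderiv_comp_apply (extChartAt I p q) d3 (d2.comp _ d1)
    (trivializationAt F (TangentSpace I) p ⟨p, v⟩).2
  have c2 := mfderiv_comp_apply (extChartAt I p q) d2 d1
    (trivializationAt F (TangentSpace I) p ⟨p, v⟩).2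
  rw [c2] at c1
  rw [mfderiv_eq_fderiv] at c1
  have d4 : (φ ∘ (extChartAt I p).symm) (extChartAt I p q) = φ q := congrArg φ d0
  rw [d4, d0] at c1
  exact c1.symm

end Extend

/-! ### Symmetry of the Hessian of a smooth map. -/

section Extend

variable {E : Type*} [NormedAddCommGroup E] [NormedSpace ℝ E]
  {M : Type*} [TopologicalSpace M] [ChartedSpace E M] [IsManifold 𝓘(ℝ, E) ∞ M]
  {F : Type*} [NormedAddCommGroup F] [NormedSpace ℝ F] {K : Type*}
  [TopologicalSpace K] {I : ModelWithCorners ℝ F K} [I.Boundaryless] {N : Type*}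
  [TopologicalSpace N] [ChartedSpace K N] [IsManifold I 1 N]

theorem contDiffAt_writtenInExtChartAt {φ : N → M} {p : N}
    (hφ : ContMDiffAt I 𝓘(ℝ, E) ∞ φ p) :
    ContDiffAt ℝ ∞ (writtenInExtChartAt I 𝓘(ℝ, E) p φ) (extChartAt I p p) := by
  have h := (contMDiffAt_iff.1 hφ).2
  rwa [I.range_eq_univ, contDiffWithinAt_univ] at h

theorem differentiableAt_fderiv_writtenInExtChartAt {φ : N → M} {p : N}
    (hφ : ContMDiffAt I 𝓘(ℝ, E) ∞ φ p) :
    DifferentiableAt ℝ (fderiv ℝ (writtenInExtChartAt I 𝓘(ℝ, E) p φ)) (extChartAt I p p) :=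
  ((contDiffAt_writtenInExtChartAt hφ).fderiv_right (m := 1) (by norm_cast)).differentiableAt
    one_ne_zero

theorem eventually_mdifferentiableAt {φ : N → M} (hφ : ContMDiff I 𝓘(ℝ, E) ∞ φ) (p : N) :
    ∀ᶠ q in nhds p, MDifferentiableAt I 𝓘(ℝ, E) φ q :=
  Filter.Eventually.of_forall fun q => hφ.mdifferentiableAt (by simp)

theorem hasMFDerivAt_fderiv_writtenInExtChartAt {φ : N → M} {p : N}
    (hφ : ContMDiffAt I 𝓘(ℝ, E) ∞ φ p) (w : F) :
    HasMFDerivAt I 𝓘(ℝ, E)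
      (fun q => fderiv ℝ (writtenInExtChartAt I 𝓘(ℝ, E) p φ) (extChartAt I p q) w) p
      ((fderiv ℝ (fderiv ℝ (writtenInExtChartAt I 𝓘(ℝ, E) p φ)) (extChartAt I p p)).flip w ∘L
        mfderiv I 𝓘(ℝ, F) (extChartAt I p) p) := by
  have h1 := (differentiableAt_fderiv_writtenInExtChartAt hφ).hasFDerivAt.clm_apply
    (hasFDerivAt_const w (extChartAt I p p))
  have h2 := (mdifferentiableAt_extChartAt (I := I) (mem_chart_source K p)).hasMFDerivAt
  rw [ContinuousLinearMap.comp_zero, zero_add] at h1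
  exact HasMFDerivAt.comp p h1.hasMFDerivAt h2

theorem mdifferentiableAt_mfderiv_extend {φ : N → M} (hφ : ContMDiff I 𝓘(ℝ, E) ∞ φ) {p : N}
    (v : TangentSpace I p) :
    MDifferentiableAt I 𝓘(ℝ, E) (fun q => (trivializationAt E (TangentSpace 𝓘(ℝ, E)) (φ p)
        ⟨φ q, mfderiv I 𝓘(ℝ, E) φ q (FiberBundle.extend F v q)⟩).2) p :=
  (hasMFDerivAt_fderiv_writtenInExtChartAt hφ.contMDiffAt _).mdifferentiableAt.congr_of_eventuallyEq
    (eventually_trivialization_mfderiv_extend (eventually_mdifferentiableAt hφ p) v)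

/-- Both sides are the second derivative of the coordinate expression of `φ`, evaluated on the
components of `u` and `v`. -/
theorem mvfderiv_mfderiv_extend_comm {φ : N → M} (hφ : ContMDiff I 𝓘(ℝ, E) ∞ φ) {p : N}
    (u v : TangentSpace I p) :
    mvfderiv I (fun q => (trivializationAt E (TangentSpace 𝓘(ℝ, E)) (φ p)
        ⟨φ q, mfderiv I 𝓘(ℝ, E) φ q (FiberBundle.extend F v q)⟩).2) p u =
    mvfderiv I (fun q => (trivializationAt E (TangentSpace 𝓘(ℝ, E)) (φ p)
        ⟨φ q, mfderiv I 𝓘(ℝ, E) φ q (FiberBundle.extend F u q)⟩).2) p v := by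
  have key : ∀ u v : TangentSpace I p,
      mvfderiv I (fun q => (trivializationAt E (TangentSpace 𝓘(ℝ, E)) (φ p)
        ⟨φ q, mfderiv I 𝓘(ℝ, E) φ q (FiberBundle.extend F v q)⟩).2) p u =
      fderiv ℝ (fderiv ℝ (writtenInExtChartAt I 𝓘(ℝ, E) p φ)) (extChartAt I p p)
        (trivializationAt F (TangentSpace I) p ⟨p, u⟩).2
        (trivializationAt F (TangentSpace I) p ⟨p, v⟩).2 := by
    intro u v
    rw [mvfderiv_congr_of_eventuallyEq (eventually_trivialization_mfderiv_extend
      (eventually_mdifferentiableAt hφ p) v)]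
    have h := congr($((hasMFDerivAt_fderiv_writtenInExtChartAt (I := I) hφ.contMDiffAt
      (trivializationAt F (TangentSpace I) p ⟨p, v⟩).2).mfderiv) u)
    -- The differential of the chart at its own base point is the trivialization, so it turns `u`
    -- into its components.
    rw [← TangentBundle.continuousLinearMapAt_trivializationAt (mem_chart_source K p)] at h
    have e := Trivialization.continuousLinearMapAt_apply_of_mem ℝ
      (trivializationAt F (TangentSpace I) p) (FiberBundle.mem_baseSet_trivializationAt' p) u
    rw [← e]
    exact h
  rw [key, key]
  have hs : IsSymmSndFDerivAt ℝ (writtenInExtChartAt I 𝓘(ℝ, E) p φ) (extChartAt I p p) :=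
    (contDiffAt_writtenInExtChartAt hφ.contMDiffAt).isSymmSndFDerivAt
      (by rw [minSmoothness_of_isRCLikeNormedField]; exact ENat.LEInfty.out)
  exact hs _ _

variable [FiniteDimensional ℝ E] [RiemannianBundle (fun x : M => TangentSpace 𝓘(ℝ, E) x)]
  [IsContMDiffRiemannianBundle 𝓘(ℝ, E) ∞ E (fun x : M => TangentSpace 𝓘(ℝ, E) x)]

/-- The Hessian `∇_u dφ(v)` of a map is symmetric. -/
theorem covDerivAlong_mfderiv_extend_comm {φ : N → M} (hφ : ContMDiff I 𝓘(ℝ, E) ∞ φ) {p : N}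
    (u v : TangentSpace I p) :
    covDerivAlong I φ (fun q => mfderiv I 𝓘(ℝ, E) φ q (FiberBundle.extend F v q)) p u =
      covDerivAlong I φ (fun q => mfderiv I 𝓘(ℝ, E) φ q (FiberBundle.extend F u q)) p v := by
  unfold covDerivAlong componentDeriv
  beta_reduce
  rw [FiberBundle.extend_apply_self, FiberBundle.extend_apply_self, christoffel_comm]
  congr 1
  exact congrArg _ (mvfderiv_mfderiv_extend_comm hφ u v)

end Extend

/-! ### Parallelism of `J` and of the metric along a map. -/

section AlongMaps

variable {E : Type*} [NormedAddCommGroup E] [NormedSpace ℝ E]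
  {M : Type*} [TopologicalSpace M] [ChartedSpace E M] [IsManifold 𝓘(ℝ, E) ∞ M]
  {F : Type*} [NormedAddCommGroup F] [NormedSpace ℝ F] {K : Type*}
  [TopologicalSpace K] {I : ModelWithCorners ℝ F K} {N : Type*}
  [TopologicalSpace N] [ChartedSpace K N]

variable (I) in
/-- A vector field along `φ` is differentiable at `p` when its components in the preferred chart at
`φ p` are. -/
def DifferentiableAlong (φ : N → M) (V : ∀ q : N, TangentSpace 𝓘(ℝ, E) (φ q)) (p : N) : Prop :=
  MDifferentiableAt I 𝓘(ℝ, E)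
    (fun q => (trivializationAt E (TangentSpace 𝓘(ℝ, E)) (φ p) ⟨φ q, V q⟩).2) p

theorem symmL_trivialization_apply {x y : M}
    (hy : y ∈ (trivializationAt E (TangentSpace 𝓘(ℝ, E)) x).baseSet)
    (v : TangentSpace 𝓘(ℝ, E) y) :
    (trivializationAt E (TangentSpace 𝓘(ℝ, E)) x).symmL ℝ y
      (trivializationAt E (TangentSpace 𝓘(ℝ, E)) x ⟨y, v⟩).2 = v := by
  rw [← Trivialization.continuousLinearMapAt_apply_of_mem ℝ _ hy]
  exact Trivialization.symmL_continuousLinearMapAt _ hy v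

theorem eventually_mem_baseSet {φ : N → M} {p : N} (hφ : ContinuousAt φ p) :
    ∀ᶠ q in nhds p, φ q ∈ (trivializationAt E (TangentSpace 𝓘(ℝ, E)) (φ p)).baseSet :=
  hφ ((trivializationAt E (TangentSpace 𝓘(ℝ, E)) (φ p)).open_baseSet.mem_nhds
    (FiberBundle.mem_baseSet_trivializationAt' (φ p)))

/-- The coordinate expression of `J` in the preferred chart at `x`. -/
noncomputable def endomorphismCoord
    (J : ∀ x : M, TangentSpace 𝓘(ℝ, E) x →L[ℝ] TangentSpace 𝓘(ℝ, E) x) (x y : M) : E →L[ℝ] E :=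
  (trivializationAt E (TangentSpace 𝓘(ℝ, E)) x).continuousLinearMapAt ℝ y ∘L J y ∘L
    (trivializationAt E (TangentSpace 𝓘(ℝ, E)) x).symmL ℝ y

variable {J : ∀ x : M, TangentSpace 𝓘(ℝ, E) x →L[ℝ] TangentSpace 𝓘(ℝ, E) x}

theorem trivialization_apply_eq_coord {x y : M}
    (hy : y ∈ (trivializationAt E (TangentSpace 𝓘(ℝ, E)) x).baseSet)
    (v : TangentSpace 𝓘(ℝ, E) y) :
    (trivializationAt E (TangentSpace 𝓘(ℝ, E)) x ⟨y, J y v⟩).2 =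
      endomorphismCoord J x y (trivializationAt E (TangentSpace 𝓘(ℝ, E)) x ⟨y, v⟩).2 := by
  unfold endomorphismCoord
  rw [ContinuousLinearMap.comp_apply, ContinuousLinearMap.comp_apply,
    symmL_trivialization_apply hy, Trivialization.continuousLinearMapAt_apply_of_mem ℝ _ hy]

theorem trivialization_extend {x y : M} (v : TangentSpace 𝓘(ℝ, E) x)
    (hy : y ∈ (trivializationAt E (TangentSpace 𝓘(ℝ, E)) x).baseSet) :
    (trivializationAt E (TangentSpace 𝓘(ℝ, E)) x ⟨y, FiberBundle.extend E v y⟩).2 =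
      (trivializationAt E (TangentSpace 𝓘(ℝ, E)) x ⟨x, v⟩).2 :=
  (congrArg Prod.snd (Trivialization.apply_mk_symm
      (trivializationAt E (TangentSpace 𝓘(ℝ, E)) x) hy
      (trivializationAt E (TangentSpace 𝓘(ℝ, E)) x ⟨x, v⟩).2) :)

variable [FiniteDimensional ℝ E] [RiemannianBundle (fun x : M => TangentSpace 𝓘(ℝ, E) x)]
  [IsContMDiffRiemannianBundle 𝓘(ℝ, E) ∞ E (fun x : M => TangentSpace 𝓘(ℝ, E) x)]

theorem IsKaehler.mdifferentiableAt_coord (hJ : IsKaehler J) (x : M) :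
    MDifferentiableAt 𝓘(ℝ, E) 𝓘(ℝ, E →L[ℝ] E) (endomorphismCoord J x) x :=
  ((mdifferentiableAt_hom_bundle _).1 (hJ.contMDiff.mdifferentiableAt (x := x) (by simp))).2

theorem IsKaehler.differentiableAlong (hJ : IsKaehler J) {φ : N → M} {p : N}
    (hφ : MDifferentiableAt I 𝓘(ℝ, E) φ p) {V : ∀ q : N, TangentSpace 𝓘(ℝ, E) (φ q)}
    (hV : DifferentiableAlong I φ V p) :
    DifferentiableAlong I φ (fun q => J (φ q) (V q)) p := by
  have h1 := ((hJ.mdifferentiableAt_coord (φ p)).comp p hφ).clm_apply hV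
  refine h1.congr_of_eventuallyEq ?_
  filter_upwards [eventually_mem_baseSet (E := E) hφ.continuousAt] with q hq
  exact trivialization_apply_eq_coord hq _

/-- This is `∇J = 0` as a pointwise identity `(∂_w J) v + Γ(J v, w) = J Γ(v, w)`, obtained by
testing parallelism on a field constant in the chart. In this form it can be pulled back along `φ`,
where a field need not be the restriction of a field on `M`. -/
theorem IsKaehler.symmL_mvfderiv_coord (hJ : IsKaehler J) (x : M) (v w : TangentSpace 𝓘(ℝ, E) x) :
    (trivializationAt E (TangentSpace 𝓘(ℝ, E)) x).symmL ℝ x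
        (mvfderiv 𝓘(ℝ, E) (endomorphismCoord J x) x w
          (trivializationAt E (TangentSpace 𝓘(ℝ, E)) x ⟨x, v⟩).2) + christoffel x (J x v) w =
      J x (christoffel x v w) := by
  have h1 := hJ.parallel (FiberBundle.extend E v) x
    (FiberBundle.mdifferentiableAt_extend 𝓘(ℝ, E) E v) w
  rw [leviCivita_extend] at h1
  rw [← h1]
  change _ = componentDeriv 𝓘(ℝ, E) (fun y : M => y) (fun y => J y (FiberBundle.extend E v y)) x w +
    christoffel x (J x (FiberBundle.extend E v x)) w
  rw [FiberBundle.extend_apply_self]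
  congr 1
  refine congrArg _ ?_
  -- The extension has constant components, so only the derivative of the matrix of `J` survives in
  -- the product rule.
  have h2 := mvfderiv_clm_apply (hJ.mdifferentiableAt_coord x)
    (mdifferentiableAt_const (c := (trivializationAt E (TangentSpace 𝓘(ℝ, E)) x ⟨x, v⟩).2)) w
  rw [mvfderiv_const] at h2
  refine Eq.trans ?_ ((mvfderiv_congr_of_eventuallyEq ?_ w).trans h2).symm
  · simp
  · filter_upwards [(trivializationAt E (TangentSpace 𝓘(ℝ, E)) x).open_baseSet.mem_nhds
      (FiberBundle.mem_baseSet_trivializationAt' x)] with y hy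
    rw [trivialization_apply_eq_coord hy]
    congr 1
    exact trivialization_extend v hy

/-- `J` is parallel along maps: `∇_u (J V) = J (∇_u V)`. -/
theorem IsKaehler.covDerivAlong_map (hJ : IsKaehler J) {φ : N → M} {p : N}
    (hφ : MDifferentiableAt I 𝓘(ℝ, E) φ p) {V : ∀ q : N, TangentSpace 𝓘(ℝ, E) (φ q)}
    (hV : DifferentiableAlong I φ V p) (u : TangentSpace I p) :
    covDerivAlong I φ (fun q => J (φ q) (V q)) p u = J (φ p) (covDerivAlong I φ V p u) := by
  have h1 := mvfderiv_clm_apply ((hJ.mdifferentiableAt_coord (φ p)).comp p hφ) hV u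
  have h0 : (fun q => (trivializationAt E (TangentSpace 𝓘(ℝ, E)) (φ p) ⟨φ q, J (φ q) (V q)⟩).2)
      =ᶠ[nhds p] fun q => (endomorphismCoord J (φ p) ∘ φ) q
        (trivializationAt E (TangentSpace 𝓘(ℝ, E)) (φ p) ⟨φ q, V q⟩).2 := by
    filter_upwards [eventually_mem_baseSet (E := E) hφ.continuousAt] with q hq
    exact trivialization_apply_eq_coord hq _
  have h2 := (mvfderiv_congr_of_eventuallyEq h0 u).trans h1
  have h3 : mvfderiv I (endomorphismCoord J (φ p) ∘ φ) p u = _ :=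
    mvfderiv_comp_map (hJ.mdifferentiableAt_coord (φ p)) hφ u
  rw [h3] at h2
  -- The product rule yields `(∂J) V + J ∂V`; this identity absorbs the first term together with the
  -- Christoffel term of `J V`.
  have h4 := hJ.symmL_mvfderiv_coord (φ p) (V p) (mfderiv I 𝓘(ℝ, E) φ p u)
  have h5 : ∀ w : E, (trivializationAt E (TangentSpace 𝓘(ℝ, E)) (φ p)).symmL ℝ (φ p)
      (endomorphismCoord J (φ p) (φ p) w) =
      J (φ p) ((trivializationAt E (TangentSpace 𝓘(ℝ, E)) (φ p)).symmL ℝ (φ p) w) := fun w =>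
    Trivialization.symmL_continuousLinearMapAt _
      (FiberBundle.mem_baseSet_trivializationAt' (φ p)) _
  unfold covDerivAlong componentDeriv
  rw [map_add, ← h4, ContinuousLinearMap.comp_apply, h2, map_add, ContinuousLinearMap.comp_apply,
    Function.comp_apply, h5]
  abel

/-- The coordinate expression of the metric in the preferred chart at `x`. -/
noncomputable def metricCoord (x y : M) : E →L[ℝ] E →L[ℝ] ℝ :=
  LinearMap.toContinuousBilinearMap ((innerₗ (TangentSpace 𝓘(ℝ, E) y)).compl₁₂
    ((trivializationAt E (TangentSpace 𝓘(ℝ, E)) x).symmL ℝ y).toLinearMap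
    ((trivializationAt E (TangentSpace 𝓘(ℝ, E)) x).symmL ℝ y).toLinearMap)

theorem metricCoord_apply (x y : M) (a b : E) : metricCoord x y a b =
    inner ℝ ((trivializationAt E (TangentSpace 𝓘(ℝ, E)) x).symmL ℝ y a)
      ((trivializationAt E (TangentSpace 𝓘(ℝ, E)) x).symmL ℝ y b) := rfl

theorem inner_eq_metricCoord {x y : M}
    (hy : y ∈ (trivializationAt E (TangentSpace 𝓘(ℝ, E)) x).baseSet)
    (v w : TangentSpace 𝓘(ℝ, E) y) :
    inner ℝ v w = metricCoord x y (trivializationAt E (TangentSpace 𝓘(ℝ, E)) x ⟨y, v⟩).2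
      (trivializationAt E (TangentSpace 𝓘(ℝ, E)) x ⟨y, w⟩).2 := by
  rw [metricCoord_apply, symmL_trivialization_apply hy, symmL_trivialization_apply hy]

/-- Near `x` the coordinate metric is the coordinate expression of the smooth section that defines
the Riemannian structure. -/
theorem mdifferentiableAt_metricCoord (x : M) :
    MDifferentiableAt 𝓘(ℝ, E) 𝓘(ℝ, E →L[ℝ] E →L[ℝ] ℝ) (metricCoord (E := E) x) x := by
  obtain ⟨g, hg, hinner⟩ := IsContMDiffRiemannianBundle.exists_contMDiff (IB := 𝓘(ℝ, E)) (n := ∞)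
    (F := E) (E := fun x : M => TangentSpace 𝓘(ℝ, E) x)
  have h := ((mdifferentiableAt_hom_bundle _).1 (hg.mdifferentiableAt (x := x) (by simp))).2
  refine h.congr_of_eventuallyEq ?_
  filter_upwards [(trivializationAt E (TangentSpace 𝓘(ℝ, E)) x).open_baseSet.mem_nhds
      (FiberBundle.mem_baseSet_trivializationAt' x)] with y hy
  ext a b
  rw [inCoordinates_apply_eq₂ hy hy (Set.mem_univ _)]
  rw [metricCoord_apply, hinner]
  simp [Trivialization.symmL_apply _ hy]

/-- This is `∇g = 0` in coordinates: of the six terms in the two Christoffel symbols of the first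
kind, all but the derivative of `g(v, w)` cancel. -/
theorem mvfderiv_metricCoord (x : M) (v w u : TangentSpace 𝓘(ℝ, E) x) :
    mvfderiv 𝓘(ℝ, E) (metricCoord x) x u (trivializationAt E (TangentSpace 𝓘(ℝ, E)) x ⟨x, v⟩).2
      (trivializationAt E (TangentSpace 𝓘(ℝ, E)) x ⟨x, w⟩).2 =
      inner ℝ (christoffel x v u) w + inner ℝ v (christoffel x w u) := by
  have h1 := mvfderiv_clm_apply (mdifferentiableAt_metricCoord x)
    (mdifferentiableAt_const (c := (trivializationAt E (TangentSpace 𝓘(ℝ, E)) x ⟨x, v⟩).2)) u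
  have h2 := mvfderiv_clm_apply ((mdifferentiableAt_metricCoord x).clm_apply
    (mdifferentiableAt_const (c := (trivializationAt E (TangentSpace 𝓘(ℝ, E)) x ⟨x, v⟩).2)))
    (mdifferentiableAt_const (c := (trivializationAt E (TangentSpace 𝓘(ℝ, E)) x ⟨x, w⟩).2)) u
  rw [h1, mvfderiv_const, mvfderiv_const] at h2
  have h3 : metricDeriv x v w u = mvfderiv 𝓘(ℝ, E) (metricCoord x) x u
      (trivializationAt E (TangentSpace 𝓘(ℝ, E)) x ⟨x, v⟩).2
      (trivializationAt E (TangentSpace 𝓘(ℝ, E)) x ⟨x, w⟩).2 := by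
    refine (mvfderiv_congr_of_eventuallyEq ?_ u).trans (h2.trans (by simp))
    filter_upwards [(trivializationAt E (TangentSpace 𝓘(ℝ, E)) x).open_baseSet.mem_nhds
      (FiberBundle.mem_baseSet_trivializationAt' x)] with y hy
    rw [inner_eq_metricCoord hy, trivialization_extend v hy, trivialization_extend w hy]
  rw [← h3, real_inner_comm _ v, inner_christoffel, inner_christoffel]
  unfold christoffelForm
  rw [metricDeriv_comm x w v, metricDeriv_comm x w u, metricDeriv_comm x u v]
  ring

/-- The covariant derivative along a map is compatible with the metric. -/
theorem mvfderiv_inner_along {φ : N → M} {p : N} (hφ : MDifferentiableAt I 𝓘(ℝ, E) φ p)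
    {V W : ∀ q : N, TangentSpace 𝓘(ℝ, E) (φ q)} (hV : DifferentiableAlong I φ V p)
    (hW : DifferentiableAlong I φ W p) (u : TangentSpace I p) :
    mvfderiv I (fun q => inner ℝ (V q) (W q)) p u =
      inner ℝ (covDerivAlong I φ V p u) (W p) + inner ℝ (V p) (covDerivAlong I φ W p u) := by
  have hA := (mdifferentiableAt_metricCoord (φ p)).comp p hφ
  have h1 := mvfderiv_clm_apply hA hV u
  have h2 := mvfderiv_clm_apply (hA.clm_apply hV) hW u
  have h3 : mvfderiv I (metricCoord (φ p) ∘ φ) p u = _ :=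
    mvfderiv_comp_map (mdifferentiableAt_metricCoord (φ p)) hφ u
  rw [h1, h3] at h2
  have h0 : (fun q => inner ℝ (V q) (W q)) =ᶠ[nhds p] fun q => (metricCoord (φ p) ∘ φ) q
      (trivializationAt E (TangentSpace 𝓘(ℝ, E)) (φ p) ⟨φ q, V q⟩).2
      (trivializationAt E (TangentSpace 𝓘(ℝ, E)) (φ p) ⟨φ q, W q⟩).2 := by
    filter_upwards [eventually_mem_baseSet (E := E) hφ.continuousAt] with q hq
    exact inner_eq_metricCoord hq _ _
  have hp := FiberBundle.mem_baseSet_trivializationAt' (F := E) (E := TangentSpace 𝓘(ℝ, E)) (φ p)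
  rw [mvfderiv_congr_of_eventuallyEq h0 u, h2, add_apply, mvfderiv_metricCoord,
    Function.comp_apply, metricCoord_apply, metricCoord_apply, symmL_trivialization_apply hp,
    symmL_trivialization_apply hp]
  unfold covDerivAlong componentDeriv
  rw [inner_add_left, inner_add_right, ContinuousLinearMap.comp_apply,
    ContinuousLinearMap.comp_apply]
  ring

end AlongMaps

/-! ### The Koszul formula and the second fundamental form. -/

section Koszul

variable {E : Type*} [NormedAddCommGroup E] [NormedSpace ℝ E] [FiniteDimensional ℝ E]
  {M : Type*} [TopologicalSpace M] [ChartedSpace E M] [IsManifold 𝓘(ℝ, E) ∞ M]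
  [RiemannianBundle (fun x : M => TangentSpace 𝓘(ℝ, E) x)]
  [IsContMDiffRiemannianBundle 𝓘(ℝ, E) ∞ E (fun x : M => TangentSpace 𝓘(ℝ, E) x)]
  {F : Type*} [NormedAddCommGroup F] [NormedSpace ℝ F] {K : Type*}
  [TopologicalSpace K] {I : ModelWithCorners ℝ F K} [I.Boundaryless] {N : Type*}
  [TopologicalSpace N] [ChartedSpace K N] [IsManifold I 1 N]

variable (E I) in
/-- The image under `dφ` of the extension `extend F v` of a tangent vector `v`. -/
noncomputable def extendAlong (φ : N → M) {p : N} (v : TangentSpace I p) (q : N) :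
    TangentSpace 𝓘(ℝ, E) (φ q) :=
  mfderiv I 𝓘(ℝ, E) φ q (FiberBundle.extend F v q)

theorem extendAlong_self (φ : N → M) {p : N} (v : TangentSpace I p) :
    extendAlong E I φ v p = mfderiv I 𝓘(ℝ, E) φ p v := by
  unfold extendAlong
  rw [FiberBundle.extend_apply_self]

theorem differentiableAlong_extendAlong {φ : N → M} (hφ : ContMDiff I 𝓘(ℝ, E) ∞ φ) {p : N}
    (v : TangentSpace I p) : DifferentiableAlong I φ (extendAlong E I φ v) p :=
  mdifferentiableAt_mfderiv_extend hφ v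

theorem covDerivAlong_extendAlong_comm {φ : N → M} (hφ : ContMDiff I 𝓘(ℝ, E) ∞ φ) {p : N}
    (u v : TangentSpace I p) :
    covDerivAlong I φ (extendAlong E I φ v) p u = covDerivAlong I φ (extendAlong E I φ u) p v :=
  covDerivAlong_mfderiv_extend_comm hφ u v

/-- Differentiate `⟨V, W⟩ = 0`; this is why orthogonality is required on a neighbourhood and not
only at `p`. -/
theorem inner_covDerivAlong_of_orthogonal {φ : N → M} {p : N}
    (hφ : MDifferentiableAt I 𝓘(ℝ, E) φ p) {V W : ∀ q : N, TangentSpace 𝓘(ℝ, E) (φ q)}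
    (hV : DifferentiableAlong I φ V p) (hW : DifferentiableAlong I φ W p)
    (h : ∀ᶠ q in nhds p, inner ℝ (V q) (W q) = 0) (u : TangentSpace I p) :
    inner ℝ (covDerivAlong I φ V p u) (W p) = -inner ℝ (V p) (covDerivAlong I φ W p u) := by
  have h1 := mvfderiv_inner_along hφ hV hW u
  rw [mvfderiv_eq_zero_of_eventuallyEq h] at h1
  linarith

/-- The Koszul formula, for fields `u`, `a`, `c` constant in a chart with `u` orthogonal to `a` and
`c`. -/
theorem inner_covDerivAlong_extendAlong {φ : N → M} (hφ : ContMDiff I 𝓘(ℝ, E) ∞ φ) {p : N}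
    {u a c : TangentSpace I p}
    (hua : ∀ᶠ q in nhds p, inner ℝ (extendAlong E I φ u q) (extendAlong E I φ a q) = 0)
    (huc : ∀ᶠ q in nhds p, inner ℝ (extendAlong E I φ u q) (extendAlong E I φ c q) = 0) :
    inner ℝ (covDerivAlong I φ (extendAlong E I φ a) p u) (mfderiv I 𝓘(ℝ, E) φ p c) =
      mvfderiv I (fun q => inner ℝ (extendAlong E I φ a q) (extendAlong E I φ c q)) p u / 2 := by
  have hd : MDifferentiableAt I 𝓘(ℝ, E) φ p := hφ.mdifferentiableAt (by simp)
  have du := differentiableAlong_extendAlong hφ u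
  have da := differentiableAlong_extendAlong hφ a
  have dc := differentiableAlong_extendAlong hφ c
  have h1 := mvfderiv_inner_along hd da dc u
  have h2 := inner_covDerivAlong_of_orthogonal hd du dc huc a
  have h3 := inner_covDerivAlong_of_orthogonal hd du da hua c
  -- After exchanging arguments by symmetry, `⟨∇_u a, c⟩` and `⟨∇_u c, a⟩` both equal `-⟨u, ∇_a c⟩`,
  -- so each is half of `u⟨a, c⟩`.
  rw [covDerivAlong_extendAlong_comm hφ a u] at h2
  rw [covDerivAlong_extendAlong_comm hφ c u, covDerivAlong_extendAlong_comm hφ c a,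
    real_inner_comm] at h3
  rw [← extendAlong_self]
  linarith

variable {J : ∀ x : M, TangentSpace 𝓘(ℝ, E) x →L[ℝ] TangentSpace 𝓘(ℝ, E) x}

theorem IsKaehler.inner_left (hJ : IsKaehler J) (x : M) (v w : TangentSpace 𝓘(ℝ, E) x) :
    inner ℝ (J x v) w = -inner ℝ v (J x w) := by
  rw [← hJ.inner_map x v (J x w), hJ.sq, inner_neg_right, neg_neg]

theorem IsKaehler.inner_self (hJ : IsKaehler J) (x : M) (v : TangentSpace 𝓘(ℝ, E) x) :
    inner ℝ v (J x v) = 0 := by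
  have := hJ.inner_left x v v
  rw [real_inner_comm] at this
  linarith

/-- The fields `J u` and `u'` agree only at `p`. But for a field orthogonal to `b` near `p`, the
number `⟨∇_a ·, b⟩` is minus its inner product at `p` with `∇_a b`, so it depends on the value at
`p` alone. Hence `⟨∇_a (J u), b⟩ = ⟨∇_a u', b⟩`, and the Koszul formula applies to `u'`. -/
theorem IsKaehler.inner_covDerivAlong_map (hJ : IsKaehler J) {φ : N → M}
    (hφ : ContMDiff I 𝓘(ℝ, E) ∞ φ) {p : N} {u u' a b : TangentSpace I p}
    (hu : J (φ p) (mfderiv I 𝓘(ℝ, E) φ p u) = mfderiv I 𝓘(ℝ, E) φ p u')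
    (hub : ∀ᶠ q in nhds p, inner ℝ (J (φ q) (extendAlong E I φ u q)) (extendAlong E I φ b q) = 0)
    (hua' : ∀ᶠ q in nhds p, inner ℝ (extendAlong E I φ u' q) (extendAlong E I φ a q) = 0)
    (hub' : ∀ᶠ q in nhds p, inner ℝ (extendAlong E I φ u' q) (extendAlong E I φ b q) = 0) :
    inner ℝ (covDerivAlong I φ (extendAlong E I φ a) p u)
        (J (φ p) (mfderiv I 𝓘(ℝ, E) φ p b)) =
      -(mvfderiv I (fun q => inner ℝ (extendAlong E I φ a q) (extendAlong E I φ b q)) p u' / 2) := by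
  have hd : MDifferentiableAt I 𝓘(ℝ, E) φ p := hφ.mdifferentiableAt (by simp)
  have du := differentiableAlong_extendAlong hφ u
  have du' := differentiableAlong_extendAlong hφ u'
  have db := differentiableAlong_extendAlong hφ b
  have h1 := inner_covDerivAlong_of_orthogonal hd (hJ.differentiableAlong hd du) db hub a
  have h2 := inner_covDerivAlong_of_orthogonal hd du' db hub' a
  have h3 := inner_covDerivAlong_extendAlong hφ hua' hub'
  rw [hJ.covDerivAlong_map hd du, hJ.inner_left, extendAlong_self, extendAlong_self, hu] at h1
  rw [extendAlong_self, extendAlong_self, covDerivAlong_extendAlong_comm hφ a u'] at h2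
  rw [covDerivAlong_extendAlong_comm hφ u a, ← h3]
  linarith

theorem normalPart_eq (φ : N → M) (p : N) (w : TangentSpace 𝓘(ℝ, E) (φ p)) :
    normalPart I φ p w = w - (tangentPlane I φ p).starProjection w := by
  unfold normalPart
  rw [Submodule.starProjection_orthogonal_val]

/-- An orthogonal projection is self-adjoint and idempotent. -/
theorem inner_normalPart_normalPart (φ : N → M) (p : N) (v w : TangentSpace 𝓘(ℝ, E) (φ p)) :
    inner ℝ (normalPart I φ p v) (normalPart I φ p w) = inner ℝ v (normalPart I φ p w) := by
  unfold normalPart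
  rw [Submodule.inner_starProjection_left_eq_right]
  congr 1
  exact Submodule.starProjection_eq_self_iff.2 (Submodule.starProjection_apply_mem _ _)

theorem normalPart_mem (φ : N → M) (p : N) (w : TangentSpace 𝓘(ℝ, E) (φ p)) :
    normalPart I φ p w ∈ (tangentPlane I φ p)ᗮ :=
  Submodule.starProjection_apply_mem _ _

theorem secondFundamentalForm_eq (φ : N → M) (p : N) (u v : TangentSpace I p) :
    (secondFundamentalForm I φ p u v : TangentSpace 𝓘(ℝ, E) (φ p)) =
      normalPart I φ p (covDerivAlong I φ (extendAlong E I φ v) p u) := rfl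

/-- The components of the second fundamental form along `F b`, where `F b` is the normal part of
`J b` and `c` is its tangential part. -/
theorem IsKaehler.inner_secondFundamentalForm (hJ : IsKaehler J) {φ : N → M}
    (hφ : ContMDiff I 𝓘(ℝ, E) ∞ φ) {p : N} {u u' a b c : TangentSpace I p}
    (hu : J (φ p) (mfderiv I 𝓘(ℝ, E) φ p u) = mfderiv I 𝓘(ℝ, E) φ p u')
    (hc : (tangentPlane I φ p).starProjection (J (φ p) (mfderiv I 𝓘(ℝ, E) φ p b)) =
      mfderiv I 𝓘(ℝ, E) φ p c)
    (hub : ∀ᶠ q in nhds p, inner ℝ (J (φ q) (extendAlong E I φ u q)) (extendAlong E I φ b q) = 0)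
    (hua : ∀ᶠ q in nhds p, inner ℝ (extendAlong E I φ u q) (extendAlong E I φ a q) = 0)
    (huc : ∀ᶠ q in nhds p, inner ℝ (extendAlong E I φ u q) (extendAlong E I φ c q) = 0)
    (hua' : ∀ᶠ q in nhds p, inner ℝ (extendAlong E I φ u' q) (extendAlong E I φ a q) = 0)
    (hub' : ∀ᶠ q in nhds p, inner ℝ (extendAlong E I φ u' q) (extendAlong E I φ b q) = 0) :
    inner ℝ (secondFundamentalForm I φ p u a : TangentSpace 𝓘(ℝ, E) (φ p))
        (normalPart I φ p (J (φ p) (mfderiv I 𝓘(ℝ, E) φ p b))) =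
      -(mvfderiv I (fun q => inner ℝ (extendAlong E I φ a q) (extendAlong E I φ b q)) p u' / 2) -
        mvfderiv I (fun q => inner ℝ (extendAlong E I φ a q) (extendAlong E I φ c q)) p u / 2 := by
  rw [secondFundamentalForm_eq, inner_normalPart_normalPart, normalPart_eq, hc, inner_sub_right,
    hJ.inner_covDerivAlong_map hφ hu hub hua' hub',
    inner_covDerivAlong_extendAlong hφ hua huc]

end Koszul

/-! ### Maps that are linear in charts. -/

section Naturality

variable {E : Type*} [NormedAddCommGroup E] [NormedSpace ℝ E]
  {M : Type*} [TopologicalSpace M] [ChartedSpace E M] [IsManifold 𝓘(ℝ, E) ∞ M]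
  {F : Type*} [NormedAddCommGroup F] [NormedSpace ℝ F] {K : Type*}
  [TopologicalSpace K] {I : ModelWithCorners ℝ F K} [I.Boundaryless] {N : Type*}
  [TopologicalSpace N] [ChartedSpace K N] [IsManifold I 1 N]

/-- A map which is linear in the charts at `p` and `ψ p` maps fields constant in the first chart to
fields constant in the second one. -/
theorem eventually_mfderiv_extend {ψ : N → M} {p : N}
    (hψ : ∀ᶠ q in nhds p, MDifferentiableAt I 𝓘(ℝ, E) ψ q) (L : F →L[ℝ] E)
    (hL : writtenInExtChartAt I 𝓘(ℝ, E) p ψ =ᶠ[nhds (extChartAt I p p)] L)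
    (v : TangentSpace I p) :
    ∀ᶠ q in nhds p, mfderiv I 𝓘(ℝ, E) ψ q (FiberBundle.extend F v q) =
      FiberBundle.extend E (mfderiv I 𝓘(ℝ, E) ψ p v) (ψ q) := by
  have h1 : ∀ᶠ q in nhds p, (trivializationAt E (TangentSpace 𝓘(ℝ, E)) (ψ p)
      ⟨ψ q, mfderiv I 𝓘(ℝ, E) ψ q (FiberBundle.extend F v q)⟩).2 =
      L (trivializationAt F (TangentSpace I) p ⟨p, v⟩).2 := by
    filter_upwards [eventually_trivialization_mfderiv_extend hψ v,
      (continuousAt_extChartAt (I := I) p).eventually hL.eventually_nhds] with q hq hq'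
    rw [hq, Filter.EventuallyEq.fderiv_eq hq', L.fderiv]
  have h2 := h1.self_of_nhds
  rw [FiberBundle.extend_apply_self] at h2
  filter_upwards [h1, eventually_mem_baseSet (E := E) hψ.self_of_nhds.continuousAt] with q hq hb
  rw [← symmL_trivialization_apply hb (mfderiv I 𝓘(ℝ, E) ψ q (FiberBundle.extend F v q)), hq, ← h2,
    ← trivialization_extend _ hb, symmL_trivialization_apply hb]

theorem eventually_extend_zero (x : M) :
    ∀ᶠ y in nhds x, FiberBundle.extend E (0 : TangentSpace 𝓘(ℝ, E) x) y = 0 := by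
  have hx := FiberBundle.mem_baseSet_trivializationAt' (F := E) (E := TangentSpace 𝓘(ℝ, E)) x
  filter_upwards [(trivializationAt E (TangentSpace 𝓘(ℝ, E)) x).open_baseSet.mem_nhds hx]
    with y hy
  rw [← symmL_trivialization_apply hy (FiberBundle.extend E _ y), trivialization_extend _ hy,
    ← Trivialization.continuousLinearMapAt_apply_of_mem ℝ _ hx, map_zero, map_zero]

end Naturality

/-! ### Projections of a triple product and extensions of tangent vectors. -/

section Biwarped

variable {ET : Type*} [NormedAddCommGroup ET] [NormedSpace ℝ ET]
  {EP : Type*} [NormedAddCommGroup EP] [NormedSpace ℝ EP]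
  {ES : Type*} [NormedAddCommGroup ES] [NormedSpace ℝ ES]
  {MT : Type*} [TopologicalSpace MT] [ChartedSpace ET MT] [IsManifold 𝓘(ℝ, ET) ∞ MT]
  {MP : Type*} [TopologicalSpace MP] [ChartedSpace EP MP] [IsManifold 𝓘(ℝ, EP) ∞ MP]
  {MS : Type*} [TopologicalSpace MS] [ChartedSpace ES MS] [IsManifold 𝓘(ℝ, ES) ∞ MS]

theorem mdifferentiable_projT : MDifferentiable (prodModel ET EP ES) 𝓘(ℝ, ET)
    (fun q : MT × MP × MS => q.1) := mdifferentiable_fst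

theorem mdifferentiable_projP : MDifferentiable (prodModel ET EP ES) 𝓘(ℝ, EP)
    (fun q : MT × MP × MS => q.2.1) :=
  mdifferentiable_fst.comp mdifferentiable_snd

theorem mdifferentiable_projS : MDifferentiable (prodModel ET EP ES) 𝓘(ℝ, ES)
    (fun q : MT × MP × MS => q.2.2) :=
  mdifferentiable_snd.comp mdifferentiable_snd

theorem dprojT_apply (p : MT × MP × MS) (v : ET × EP × ES) :
    (dprojT (ET := ET) (EP := EP) (ES := ES) p v : ET) = v.1 := by
  have h : dprojT (ET := ET) (EP := EP) (ES := ES) p = ContinuousLinearMap.fst ℝ ET (EP × ES) :=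
    mfderiv_fst
  exact congr($h v)

theorem dprojP_apply (p : MT × MP × MS) (v : ET × EP × ES) :
    (dprojP (ET := ET) (EP := EP) (ES := ES) p v : EP) = v.2.1 := by
  have h := mfderiv_comp_apply (I := prodModel ET EP ES) (I' := 𝓘(ℝ, EP).prod 𝓘(ℝ, ES))
    (I'' := 𝓘(ℝ, EP)) p (g := Prod.fst) (f := (Prod.snd : MT × MP × MS → MP × MS))
    mdifferentiableAt_fst mdifferentiableAt_snd v
  rw [mfderiv_fst, mfderiv_snd] at h
  exact h

theorem dprojS_apply (p : MT × MP × MS) (v : ET × EP × ES) :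
    (dprojS (ET := ET) (EP := EP) (ES := ES) p v : ES) = v.2.2 := by
  have h := mfderiv_comp_apply (I := prodModel ET EP ES) (I' := 𝓘(ℝ, EP).prod 𝓘(ℝ, ES))
    (I'' := 𝓘(ℝ, ES)) p (g := Prod.snd) (f := (Prod.snd : MT × MP × MS → MP × MS))
    mdifferentiableAt_snd mdifferentiableAt_snd v
  rw [mfderiv_snd, mfderiv_snd] at h
  exact h

/-- Lets a statement about `df` or `dσ` on all of `T MT` be tested on vectors of `D^T`. -/
theorem exists_mem_distT (p : MT × MP × MS) (w : TangentSpace 𝓘(ℝ, ET) p.1) :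
    ∃ t ∈ distT ET EP ES p, dprojT p t = w :=
  ⟨((w, 0, 0) : ET × EP × ES), ⟨dprojP_apply p _, dprojS_apply p _⟩, dprojT_apply p _⟩

theorem eq_zero_of_dproj_eq_zero (p : MT × MP × MS) {v : TangentSpace (prodModel ET EP ES) p}
    (hT : dprojT p v = 0) (hP : dprojP p v = 0) (hS : dprojS p v = 0) : v = 0 :=
  Prod.ext ((dprojT_apply p v).symm.trans hT)
    (Prod.ext ((dprojP_apply p v).symm.trans hP) ((dprojS_apply p v).symm.trans hS))

/-- The product chart makes the projection linear, so `eventually_mfderiv_extend` applies. The same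
holds for the other two factors. -/
theorem eventually_dprojT_extend (p : MT × MP × MS) (v : TangentSpace (prodModel ET EP ES) p) :
    ∀ᶠ q in nhds p, dprojT q (FiberBundle.extend (ET × EP × ES) v q) =
      FiberBundle.extend ET (dprojT p v) q.1 := by
  refine eventually_mfderiv_extend (Filter.Eventually.of_forall fun q => mdifferentiable_projT q)
    (ContinuousLinearMap.fst ℝ ET (EP × ES)) ?_ v
  filter_upwards [extChartAt_target_mem_nhds (I := prodModel ET EP ES) p] with z hz
  rw [extChartAt_prod] at hz
  simp only [writtenInExtChartAt, Function.comp_apply, extChartAt_prod, PartialEquiv.prod_symm,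
    PartialEquiv.prod_coe]
  exact (extChartAt 𝓘(ℝ, ET) p.1).right_inv hz.1

theorem eventually_dprojP_extend (p : MT × MP × MS) (v : TangentSpace (prodModel ET EP ES) p) :
    ∀ᶠ q in nhds p, dprojP q (FiberBundle.extend (ET × EP × ES) v q) =
      FiberBundle.extend EP (dprojP p v) q.2.1 := by
  refine eventually_mfderiv_extend (Filter.Eventually.of_forall fun q => mdifferentiable_projP q)
    (ContinuousLinearMap.fst ℝ EP ES ∘L ContinuousLinearMap.snd ℝ ET (EP × ES)) ?_ v
  filter_upwards [extChartAt_target_mem_nhds (I := prodModel ET EP ES) p] with z hz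
  rw [extChartAt_prod, extChartAt_prod] at hz
  simp only [writtenInExtChartAt, Function.comp_apply, extChartAt_prod, PartialEquiv.prod_symm,
    PartialEquiv.prod_coe]
  exact (extChartAt 𝓘(ℝ, EP) p.2.1).right_inv hz.2.1

theorem eventually_dprojS_extend (p : MT × MP × MS) (v : TangentSpace (prodModel ET EP ES) p) :
    ∀ᶠ q in nhds p, dprojS q (FiberBundle.extend (ET × EP × ES) v q) =
      FiberBundle.extend ES (dprojS p v) q.2.2 := by
  refine eventually_mfderiv_extend (Filter.Eventually.of_forall fun q => mdifferentiable_projS q)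
    (ContinuousLinearMap.snd ℝ EP ES ∘L ContinuousLinearMap.snd ℝ ET (EP × ES)) ?_ v
  filter_upwards [extChartAt_target_mem_nhds (I := prodModel ET EP ES) p] with z hz
  rw [extChartAt_prod, extChartAt_prod] at hz
  simp only [writtenInExtChartAt, Function.comp_apply, extChartAt_prod, PartialEquiv.prod_symm,
    PartialEquiv.prod_coe]
  exact (extChartAt 𝓘(ℝ, ES) p.2.2).right_inv hz.2.2

theorem eventually_dprojT_extend_eq_zero {p : MT × MP × MS}
    {v : TangentSpace (prodModel ET EP ES) p} (hv : dprojT p v = 0) :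
    ∀ᶠ q in nhds p, dprojT q (FiberBundle.extend (ET × EP × ES) v q) = 0 := by
  filter_upwards [eventually_dprojT_extend p v,
    continuousAt_fst.eventually (eventually_extend_zero (E := ET) p.1)] with q h1 h2
  rw [h1, hv, h2]

/-- Constant extensions in the product chart stay tangent to the factor; this supplies the
orthogonality near `p` that the Koszul argument needs. -/
theorem eventually_extend_mem_distT {p : MT × MP × MS}
    {v : TangentSpace (prodModel ET EP ES) p} (hv : v ∈ distT ET EP ES p) :
    ∀ᶠ q in nhds p, FiberBundle.extend (ET × EP × ES) v q ∈ distT ET EP ES q := by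
  have hP : dprojP p v = 0 := hv.1
  have hS : dprojS p v = 0 := hv.2
  have c1 : ContinuousAt (fun q : MT × MP × MS => q.2.1) p := by fun_prop
  have c2 : ContinuousAt (fun q : MT × MP × MS => q.2.2) p := by fun_prop
  filter_upwards [eventually_dprojP_extend p v, eventually_dprojS_extend p v,
    c1.eventually (eventually_extend_zero (E := EP) p.2.1),
    c2.eventually (eventually_extend_zero (E := ES) p.2.2)] with q h1 h2 h3 h4
  refine ⟨?_, ?_⟩
  · change dprojP q _ = 0
    rw [h1, hP, h3]
  · change dprojS q _ = 0
    rw [h2, hS, h4]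

end Biwarped

/-! ### Functions with vanishing differential. -/

section LocallyConstant

variable {E : Type*} [NormedAddCommGroup E] [NormedSpace ℝ E]
  {M : Type*} [TopologicalSpace M] [ChartedSpace E M] [IsManifold 𝓘(ℝ, E) ∞ M]

theorem isLocallyConstant_of_mvfderiv_eq_zero {f : M → ℝ}
    (hf : MDifferentiable 𝓘(ℝ, E) 𝓘(ℝ, ℝ) f) (h : ∀ x, mvfderiv 𝓘(ℝ, E) f x = 0) :
    IsLocallyConstant f := by
  rw [IsLocallyConstant.iff_eventually_eq]
  intro x
  -- A ball inside the chart target is convex, hence connected, so a zero derivative forces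
  -- constancy on it.
  obtain ⟨r, hr, hball⟩ := Metric.mem_nhds_iff.1 (extChartAt_target_mem_nhds (I := 𝓘(ℝ, E)) x)
  have hd : ∀ z ∈ (extChartAt 𝓘(ℝ, E) x).target,
      HasFDerivAt (f ∘ (extChartAt 𝓘(ℝ, E) x).symm) (0 : E →L[ℝ] ℝ) z := by
    intro z hz
    have d1 : MDifferentiableAt 𝓘(ℝ, E) 𝓘(ℝ, E) (extChartAt 𝓘(ℝ, E) x).symm z := by
      have := mdifferentiableWithinAt_extChartAt_symm (I := 𝓘(ℝ, E)) hz
      rwa [ModelWithCorners.range_eq_univ, mdifferentiableWithinAt_univ] at this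
    have h1 := ((hf _).hasMFDerivAt.comp z d1.hasMFDerivAt).hasFDerivAt
    have h2 : mfderiv 𝓘(ℝ, E) 𝓘(ℝ, ℝ) f ((extChartAt 𝓘(ℝ, E) x).symm z) = 0 := by
      ext w
      exact congr($(h ((extChartAt 𝓘(ℝ, E) x).symm z)) w)
    rw [h2, ContinuousLinearMap.zero_comp] at h1
    exact h1
  have hx : extChartAt 𝓘(ℝ, E) x x ∈ Metric.ball (extChartAt 𝓘(ℝ, E) x x) r :=
    Metric.mem_ball_self hr
  filter_upwards [(continuousAt_extChartAt (I := 𝓘(ℝ, E)) x) (Metric.ball_mem_nhds _ hr),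
    extChartAt_source_mem_nhds (I := 𝓘(ℝ, E)) x] with y hy hy'
  have := Metric.isOpen_ball.is_const_of_fderiv_eq_zero
    (convex_ball (extChartAt 𝓘(ℝ, E) x x) r).isPreconnected
    (fun z hz => (hd z (hball hz)).differentiableAt.differentiableWithinAt)
    (fun z hz => (hd z (hball hz)).fderiv) hy hx
  rwa [Function.comp_apply, Function.comp_apply, (extChartAt 𝓘(ℝ, E) x).left_inv hy',
    extChartAt_to_inv] at this

theorem exists_eq_const_of_mvfderiv_eq_zero [ConnectedSpace M] {f : M → ℝ}
    (hf : MDifferentiable 𝓘(ℝ, E) 𝓘(ℝ, ℝ) f) (h : ∀ x, mvfderiv 𝓘(ℝ, E) f x = 0) :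
    ∃ c, ∀ x, f x = c :=
  ⟨f (Classical.arbitrary M), fun _ =>
    (isLocallyConstant_of_mvfderiv_eq_zero hf h).apply_eq_of_preconnectedSpace _ _⟩

end LocallyConstant

/-! ### Derivatives of the biwarped metric in directions of `D^T`. -/

section BiwarpedMetric

variable {ET : Type*} [NormedAddCommGroup ET] [NormedSpace ℝ ET]
  {EP : Type*} [NormedAddCommGroup EP] [NormedSpace ℝ EP] [FiniteDimensional ℝ EP]
  {ES : Type*} [NormedAddCommGroup ES] [NormedSpace ℝ ES] [FiniteDimensional ℝ ES]
  {MT : Type*} [TopologicalSpace MT] [ChartedSpace ET MT] [IsManifold 𝓘(ℝ, ET) ∞ MT]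
  [RiemannianBundle (fun x : MT => TangentSpace 𝓘(ℝ, ET) x)]
  {MP : Type*} [TopologicalSpace MP] [ChartedSpace EP MP] [IsManifold 𝓘(ℝ, EP) ∞ MP]
  [RiemannianBundle (fun x : MP => TangentSpace 𝓘(ℝ, EP) x)]
  [IsContMDiffRiemannianBundle 𝓘(ℝ, EP) ∞ EP (fun x : MP => TangentSpace 𝓘(ℝ, EP) x)]
  {MS : Type*} [TopologicalSpace MS] [ChartedSpace ES MS] [IsManifold 𝓘(ℝ, ES) ∞ MS]
  [RiemannianBundle (fun x : MS => TangentSpace 𝓘(ℝ, ES) x)]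
  [IsContMDiffRiemannianBundle 𝓘(ℝ, ES) ∞ ES (fun x : MS => TangentSpace 𝓘(ℝ, ES) x)]

/-- One warped summand of the metric: `dρ` kills `u`, so `k ∘ ρ` contributes nothing and only the
warping function is differentiated. It serves for both projections. -/
theorem mvfderiv_sq_mul_projections {f : MT → ℝ} {B : Type*} [NormedAddCommGroup B]
    [NormedSpace ℝ B] {Y : Type*} [TopologicalSpace Y] [ChartedSpace B Y] {k : Y → ℝ}
    {ρ : MT × MP × MS → Y} {p : MT × MP × MS}
    (hf : MDifferentiableAt 𝓘(ℝ, ET) 𝓘(ℝ, ℝ) f p.1)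
    (hρ : MDifferentiableAt (prodModel ET EP ES) 𝓘(ℝ, B) ρ p)
    (hk : MDifferentiableAt 𝓘(ℝ, B) 𝓘(ℝ, ℝ) k (ρ p)) {u : TangentSpace (prodModel ET EP ES) p}
    (hu : mfderiv (prodModel ET EP ES) 𝓘(ℝ, B) ρ p u = 0) :
    MDifferentiableAt (prodModel ET EP ES) 𝓘(ℝ, ℝ) (fun q => f q.1 ^ 2 * k (ρ q)) p ∧
    mvfderiv (prodModel ET EP ES) (fun q => f q.1 ^ 2 * k (ρ q)) p u =
      2 * f p.1 * mvfderiv 𝓘(ℝ, ET) f p.1 (dprojT p u) * k (ρ p) := by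
  have hf' : MDifferentiableAt (prodModel ET EP ES) 𝓘(ℝ, ℝ) (fun q => f q.1) p :=
    hf.comp p (mdifferentiable_projT p)
  have hk' : MDifferentiableAt (prodModel ET EP ES) 𝓘(ℝ, ℝ) (fun q => k (ρ q)) p := hk.comp p hρ
  have h1 : mvfderiv (prodModel ET EP ES) (fun q => f q.1) p u =
      mvfderiv 𝓘(ℝ, ET) f p.1 (dprojT p u) := mvfderiv_comp_map hf (mdifferentiable_projT p) u
  have h2 : mvfderiv (prodModel ET EP ES) (fun q => k (ρ q)) p u = 0 := by
    rw [mvfderiv_comp_map hk hρ, hu, map_zero]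
  simp only [pow_two]
  have hff : MDifferentiableAt (prodModel ET EP ES) 𝓘(ℝ, ℝ) (fun q => f q.1 * f q.1) p :=
    hf'.mul hf'
  refine ⟨hff.mul hk', ?_⟩
  rw [mvfderiv_fun_mul hff hk', mvfderiv_fun_mul hf' hf']
  simp only [add_apply, smul_apply, h1, h2, smul_eq_mul]
  ring

/-- The derivative of the metric on vectors tangent to `MP × MS`, in a direction tangent to
`MT`. -/
theorem mvfderiv_biwarpedMetric {f σ : MT → ℝ} {p : MT × MP × MS}
    (hf : MDifferentiableAt 𝓘(ℝ, ET) 𝓘(ℝ, ℝ) f p.1)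
    (hσ : MDifferentiableAt 𝓘(ℝ, ET) 𝓘(ℝ, ℝ) σ p.1) {u a b : TangentSpace (prodModel ET EP ES) p}
    (hu : u ∈ distT ET EP ES p) (ha : dprojT p a = 0) :
    mvfderiv (prodModel ET EP ES) (fun q => biwarpedMetric f σ q
      (FiberBundle.extend (ET × EP × ES) a q) (FiberBundle.extend (ET × EP × ES) b q)) p u =
      2 * f p.1 * mvfderiv 𝓘(ℝ, ET) f p.1 (dprojT p u) * inner ℝ (dprojP p a) (dprojP p b) +
      2 * σ p.1 * mvfderiv 𝓘(ℝ, ET) σ p.1 (dprojT p u) * inner ℝ (dprojS p a) (dprojS p b) := by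
  have hP := mvfderiv_sq_mul_projections hf (mdifferentiable_projP p)
    (mdifferentiableAt_inner_extend p.2.1 (dprojP p a) (dprojP p b)) hu.1
  have hS := mvfderiv_sq_mul_projections hσ (mdifferentiable_projS p)
    (mdifferentiableAt_inner_extend p.2.2 (dprojS p a) (dprojS p b)) hu.2
  have h := congr($(mvfderiv_fun_add hP.1 hS.1) u)
  rw [add_apply, hP.2, hS.2] at h
  simp only [FiberBundle.extend_apply_self] at h
  rw [← h]
  refine mvfderiv_congr_of_eventuallyEq ?_ u
  -- Near `p` the extension of `a` has no `MT`-component, so the unwarped summand of the metric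
  -- vanishes whatever `b` is.
  filter_upwards [eventually_dprojT_extend_eq_zero ha, eventually_dprojP_extend p a,
    eventually_dprojP_extend p b, eventually_dprojS_extend p a,
    eventually_dprojS_extend p b] with q h1 h2 h3 h4 h5
  unfold biwarpedMetric
  rw [h1, h2, h3, h4, h5, inner_zero_left, zero_add]

theorem biwarpedMetric_eq_zero (f σ : MT → ℝ) {p : MT × MP × MS}
    {t a : TangentSpace (prodModel ET EP ES) p} (ht : t ∈ distT ET EP ES p) (ha : dprojT p a = 0) :
    biwarpedMetric f σ p t a = 0 := by
  have h1 : dprojP p t = 0 := ht.1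
  have h2 : dprojS p t = 0 := ht.2
  simp [biwarpedMetric, h1, h2, ha]

end BiwarpedMetric

/-! ### The second fundamental form and the warping functions. -/

section MixedGeodesic

variable {E : Type*} [NormedAddCommGroup E] [NormedSpace ℝ E] [FiniteDimensional ℝ E]
  {M : Type*} [TopologicalSpace M] [ChartedSpace E M] [IsManifold 𝓘(ℝ, E) ∞ M]
  [RiemannianBundle (fun x : M => TangentSpace 𝓘(ℝ, E) x)]
  [IsContMDiffRiemannianBundle 𝓘(ℝ, E) ∞ E (fun x : M => TangentSpace 𝓘(ℝ, E) x)]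
  {J : ∀ x : M, TangentSpace 𝓘(ℝ, E) x →L[ℝ] TangentSpace 𝓘(ℝ, E) x}
  {ET : Type*} [NormedAddCommGroup ET] [NormedSpace ℝ ET] [FiniteDimensional ℝ ET]
  {EP : Type*} [NormedAddCommGroup EP] [NormedSpace ℝ EP] [FiniteDimensional ℝ EP]
  {ES : Type*} [NormedAddCommGroup ES] [NormedSpace ℝ ES] [FiniteDimensional ℝ ES]
  {MT : Type*} [TopologicalSpace MT] [ChartedSpace ET MT] [IsManifold 𝓘(ℝ, ET) ∞ MT]
  [RiemannianBundle (fun x : MT => TangentSpace 𝓘(ℝ, ET) x)]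
  {MP : Type*} [TopologicalSpace MP] [ChartedSpace EP MP] [IsManifold 𝓘(ℝ, EP) ∞ MP]
  [RiemannianBundle (fun x : MP => TangentSpace 𝓘(ℝ, EP) x)]
  [IsContMDiffRiemannianBundle 𝓘(ℝ, EP) ∞ EP (fun x : MP => TangentSpace 𝓘(ℝ, EP) x)]
  {MS : Type*} [TopologicalSpace MS] [ChartedSpace ES MS] [IsManifold 𝓘(ℝ, ES) ∞ MS]
  [RiemannianBundle (fun x : MS => TangentSpace 𝓘(ℝ, ES) x)]
  [IsContMDiffRiemannianBundle 𝓘(ℝ, ES) ∞ ES (fun x : MS => TangentSpace 𝓘(ℝ, ES) x)]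
  {f σ : MT → ℝ} {φ : MT × MP × MS → M} {θ : MT × MP × MS → ℝ}

theorem IsBiwarpedSubmanifold.eventually_orthogonal
    (hφ : IsBiwarpedSubmanifold ET EP ES E f σ φ) {p : MT × MP × MS}
    {t a : TangentSpace (prodModel ET EP ES) p} (ht : t ∈ distT ET EP ES p)
    (ha : dprojT p a = 0) :
    ∀ᶠ q in nhds p, inner ℝ (extendAlong E (prodModel ET EP ES) φ t q)
      (extendAlong E (prodModel ET EP ES) φ a q) = 0 := by
  filter_upwards [eventually_extend_mem_distT ht, eventually_dprojT_extend_eq_zero ha] with q h1 h2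
  exact (hφ.isometric q _ _).trans (biwarpedMetric_eq_zero f σ h1 h2)

theorem IsGeneralizedJInduced.exists_map_eq (hi : IsGeneralizedJInduced ET EP ES J φ θ)
    {p : MT × MP × MS} {t : TangentSpace (prodModel ET EP ES) p} (ht : t ∈ distT ET EP ES p) :
    ∃ t' ∈ distT ET EP ES p, J (φ p) (mfderiv (prodModel ET EP ES) 𝓘(ℝ, E) φ p t) =
      mfderiv (prodModel ET EP ES) 𝓘(ℝ, E) φ p t' := by
  obtain ⟨t', ht', h⟩ := hi.holomorphic p _ (Submodule.mem_map_of_mem ht)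
  exact ⟨t', ht', h.symm⟩

/-- Holomorphy is used separately at each nearby point; the vectors `t'` found there need not form a
field constant in the chart. -/
theorem IsGeneralizedJInduced.eventually_orthogonal (hi : IsGeneralizedJInduced ET EP ES J φ θ)
    (hφ : IsBiwarpedSubmanifold ET EP ES E f σ φ) {p : MT × MP × MS}
    {t a : TangentSpace (prodModel ET EP ES) p} (ht : t ∈ distT ET EP ES p)
    (ha : dprojT p a = 0) :
    ∀ᶠ q in nhds p, inner ℝ (J (φ q) (extendAlong E (prodModel ET EP ES) φ t q))
      (extendAlong E (prodModel ET EP ES) φ a q) = 0 := by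
  filter_upwards [eventually_extend_mem_distT ht, eventually_dprojT_extend_eq_zero ha] with q h1 h2
  obtain ⟨t', ht', h⟩ := hi.exists_map_eq h1
  exact (congrArg (fun w => inner ℝ w _) h).trans
    ((hφ.isometric q _ _).trans (biwarpedMetric_eq_zero f σ ht' h2))

/-- The tangential part of `J b`, for `b` tangent to `MP × MS`, is tangent to `MP × MS`. -/
theorem IsGeneralizedJInduced.exists_tangential_eq (hJ : IsKaehler J)
    (hi : IsGeneralizedJInduced ET EP ES J φ θ)
    (hφ : IsBiwarpedSubmanifold ET EP ES E f σ φ) {p : MT × MP × MS}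
    {b : TangentSpace (prodModel ET EP ES) p} (hb : dprojT p b = 0) :
    ∃ c, dprojT p c = 0 ∧ (tangentPlane (prodModel ET EP ES) φ p).starProjection
      (J (φ p) (mfderiv (prodModel ET EP ES) 𝓘(ℝ, E) φ p b)) =
        mfderiv (prodModel ET EP ES) 𝓘(ℝ, E) φ p c := by
  obtain ⟨c, hc⟩ : (tangentPlane (prodModel ET EP ES) φ p).starProjection
      (J (φ p) (mfderiv (prodModel ET EP ES) 𝓘(ℝ, E) φ p b)) ∈
      tangentPlane (prodModel ET EP ES) φ p := Submodule.starProjection_apply_mem _ _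
  refine ⟨c, ?_, hc.symm⟩
  -- The vector of `D^T` with the same `MT`-component as `c` is the test vector: its inner product
  -- with `c` is the squared length of that component, and it vanishes because `J` preserves `D^T`,
  -- which is orthogonal to `b`.
  obtain ⟨t, ht, htc⟩ := exists_mem_distT (EP := EP) (ES := ES) p (dprojT p c)
  have h1 : biwarpedMetric f σ p t c = inner ℝ (dprojT p c) (dprojT p c) := by
    have h1 : dprojP p t = 0 := ht.1
    have h2 : dprojS p t = 0 := ht.2
    simp [biwarpedMetric, h1, h2, htc]
  have h2 : inner ℝ (mfderiv (prodModel ET EP ES) 𝓘(ℝ, E) φ p t)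
      (mfderiv (prodModel ET EP ES) 𝓘(ℝ, E) φ p c) = 0 := by
    have h3 : mfderiv (prodModel ET EP ES) 𝓘(ℝ, E) φ p t ∈
      tangentPlane (prodModel ET EP ES) φ p := ⟨t, rfl⟩
    obtain ⟨t', ht', h⟩ := hi.exists_map_eq ht
    have hc' : mfderiv (prodModel ET EP ES) 𝓘(ℝ, E) φ p c = _ := hc
    rw [hc', ← Submodule.inner_starProjection_left_eq_right,
      Submodule.starProjection_eq_self_iff.2 h3]
    have h4 := hJ.inner_left _ (mfderiv (prodModel ET EP ES) 𝓘(ℝ, E) φ p t)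
      (mfderiv (prodModel ET EP ES) 𝓘(ℝ, E) φ p b)
    rw [h, hφ.isometric, biwarpedMetric_eq_zero f σ ht' hb] at h4
    linarith
  rw [hφ.isometric, h1] at h2
  exact inner_self_eq_zero.1 h2

/-- The second fundamental form on `D^T` and `D^⊥ ⊕ D^θ`, in terms of the differentials of the
warping functions. -/
theorem IsGeneralizedJInduced.inner_secondFundamentalForm (hJ : IsKaehler J)
    (hi : IsGeneralizedJInduced ET EP ES J φ θ)
    (hφ : IsBiwarpedSubmanifold ET EP ES E f σ φ) {p : MT × MP × MS}
    {u u' a b c : TangentSpace (prodModel ET EP ES) p} (hu : u ∈ distT ET EP ES p)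
    (hu' : u' ∈ distT ET EP ES p)
    (hJu : J (φ p) (mfderiv (prodModel ET EP ES) 𝓘(ℝ, E) φ p u) =
      mfderiv (prodModel ET EP ES) 𝓘(ℝ, E) φ p u')
    (ha : dprojT p a = 0) (hb : dprojT p b = 0) (hc : dprojT p c = 0)
    (hbc : (tangentPlane (prodModel ET EP ES) φ p).starProjection
      (J (φ p) (mfderiv (prodModel ET EP ES) 𝓘(ℝ, E) φ p b)) =
        mfderiv (prodModel ET EP ES) 𝓘(ℝ, E) φ p c) :
    inner ℝ (secondFundamentalForm (prodModel ET EP ES) φ p u a : TangentSpace 𝓘(ℝ, E) (φ p))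
        (normalPart (prodModel ET EP ES) φ p
          (J (φ p) (mfderiv (prodModel ET EP ES) 𝓘(ℝ, E) φ p b))) =
      -(f p.1 * mvfderiv 𝓘(ℝ, ET) f p.1 (dprojT p u') * inner ℝ (dprojP p a) (dprojP p b) +
        σ p.1 * mvfderiv 𝓘(ℝ, ET) σ p.1 (dprojT p u') * inner ℝ (dprojS p a) (dprojS p b)) -
      (f p.1 * mvfderiv 𝓘(ℝ, ET) f p.1 (dprojT p u) * inner ℝ (dprojP p a) (dprojP p c) +
        σ p.1 * mvfderiv 𝓘(ℝ, ET) σ p.1 (dprojT p u) * inner ℝ (dprojS p a) (dprojS p c)) := by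
  have hf := hφ.contMDiff_f.mdifferentiableAt (x := p.1) (by simp)
  have hσ := hφ.contMDiff_σ.mdifferentiableAt (x := p.1) (by simp)
  have key : ∀ {v d : TangentSpace (prodModel ET EP ES) p}, v ∈ distT ET EP ES p →
      mvfderiv (prodModel ET EP ES) (fun q => inner ℝ (extendAlong E (prodModel ET EP ES) φ a q)
        (extendAlong E (prodModel ET EP ES) φ d q)) p v = _ := fun {v d} hv =>
    (mvfderiv_congr_of_eventuallyEq (Filter.Eventually.of_forall fun q => hφ.isometric q _ _)
      v).trans (mvfderiv_biwarpedMetric hf hσ (b := d) hv ha)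
  rw [hJ.inner_secondFundamentalForm hφ.contMDiff_φ hJu hbc (hi.eventually_orthogonal hφ hu hb)
    (hφ.eventually_orthogonal hu ha) (hφ.eventually_orthogonal hu hc)
    (hφ.eventually_orthogonal hu' ha) (hφ.eventually_orthogonal hu' hb), key hu, key hu']
  ring

theorem IsGeneralizedJInduced.starProjection_eq_zero (hi : IsGeneralizedJInduced ET EP ES J φ θ)
    {p : MT × MP × MS} {b : TangentSpace (prodModel ET EP ES) p} (hb : b ∈ distP ET EP ES p) :
    (tangentPlane (prodModel ET EP ES) φ p).starProjection
      (J (φ p) (mfderiv (prodModel ET EP ES) 𝓘(ℝ, E) φ p b)) = 0 :=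
  Submodule.starProjection_apply_eq_zero_iff _ |>.2
    (hi.totallyReal p _ (Submodule.mem_map_of_mem hb))

/-- With `df = dσ = 0`, the vector `h(u, a)` is normal and orthogonal to all `F b`, so it lies in
the invariant normal subbundle, which is zero. Taking `a` tangent to `MP × MS` treats both mixed
geodesic conditions at once. -/
theorem IsGeneralizedJInduced.secondFundamentalForm_eq_zero (hJ : IsKaehler J)
    (hi : IsGeneralizedJInduced ET EP ES J φ θ)
    (hφ : IsBiwarpedSubmanifold ET EP ES E f σ φ) {p : MT × MP × MS}
    (hnormal : invariantNormal ET EP ES J φ p = ⊥)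
    (hf : mvfderiv 𝓘(ℝ, ET) f p.1 = 0) (hσ : mvfderiv 𝓘(ℝ, ET) σ p.1 = 0)
    {u a : TangentSpace (prodModel ET EP ES) p} (hu : u ∈ distT ET EP ES p)
    (ha : dprojT p a = 0) :
    (secondFundamentalForm (prodModel ET EP ES) φ p u a : TangentSpace 𝓘(ℝ, E) (φ p)) = 0 := by
  obtain ⟨u', hu', hJu⟩ := hi.exists_map_eq hu
  have key : ∀ b : TangentSpace (prodModel ET EP ES) p, dprojT p b = 0 →
      inner ℝ (secondFundamentalForm (prodModel ET EP ES) φ p u a : TangentSpace 𝓘(ℝ, E) (φ p))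
        (normalPart (prodModel ET EP ES) φ p
          (J (φ p) (mfderiv (prodModel ET EP ES) 𝓘(ℝ, E) φ p b))) = 0 := by
    intro b hb
    obtain ⟨c, hc, hbc⟩ := hi.exists_tangential_eq hJ hφ hb
    rw [hi.inner_secondFundamentalForm hJ hφ hu hu' hJu ha hb hc hbc, hf, hσ]
    simp
  rw [← Submodule.mem_bot ℝ, ← hnormal]
  refine ⟨?_, normalPart_mem _ _ _⟩
  refine (Submodule.mem_orthogonal' _ _).2 fun w hw => ?_
  obtain ⟨x, hx, y, hy, rfl⟩ := Submodule.mem_sup.1 hw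
  obtain ⟨_, ⟨b, hb, rfl⟩, rfl⟩ := hx
  obtain ⟨_, ⟨d, hd, rfl⟩, rfl⟩ := hy
  have h1 := key b hb.1
  -- On `D^⊥` one has `F b = J b`, which is how the first summand of the spanning subspace is
  -- written.
  rw [normalPart_eq, hi.starProjection_eq_zero hb, sub_zero] at h1
  rw [inner_add_right]
  exact (congrArg₂ (· + ·) h1 (key d hd.1)).trans (add_zero 0)

/-- If `h(D^T, D^⊥) = 0` then `f` is constant. -/
theorem IsGeneralizedJInduced.mvfderiv_eq_zero_of_isMixedGeodesic_distP (hJ : IsKaehler J)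
    (hi : IsGeneralizedJInduced ET EP ES J φ θ)
    (hφ : IsBiwarpedSubmanifold ET EP ES E f σ φ) (hne : ∀ p : MT × MP × MS, distP ET EP ES p ≠ ⊥)
    (hmixed : IsMixedGeodesic (E := E) (prodModel ET EP ES) φ (distT ET EP ES) (distP ET EP ES))
    (p : MT × MP × MS) : mvfderiv 𝓘(ℝ, ET) f p.1 = 0 := by
  obtain ⟨a, ha, ha0⟩ := Submodule.exists_mem_ne_zero_of_ne_bot (hne p)
  ext w
  obtain ⟨t, ht, rfl⟩ := exists_mem_distT (EP := EP) (ES := ES) p w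
  -- The formula sees `df` in the direction `J u`; choosing `u = J t` gives `J u = -t`, so `df` is
  -- obtained on the arbitrary vector `t`.
  obtain ⟨u, hu, hJt⟩ := hi.exists_map_eq ht
  have hJu : J (φ p) (mfderiv (prodModel ET EP ES) 𝓘(ℝ, E) φ p u) =
      mfderiv (prodModel ET EP ES) 𝓘(ℝ, E) φ p (-t) := by rw [← hJt, hJ.sq, map_neg]
  have hS : dprojS p a = 0 := ha.2
  -- Here `b = a` and `c = 0`, since `J a` is normal.
  have h := hi.inner_secondFundamentalForm hJ hφ hu (neg_mem ht) hJu ha.1 ha.1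
    (map_zero (dprojT p)) (by rw [hi.starProjection_eq_zero ha, map_zero])
  rw [hmixed p u hu a ha, hS] at h
  have hP : dprojP p a ≠ 0 := fun h0 => ha0 (eq_zero_of_dproj_eq_zero p ha.1 h0 hS)
  have hfp := (hφ.f_pos p.1).ne'
  simpa [hP, hfp] using h

/-- If `h(D^T, D^θ) = 0` then `σ` is constant. -/
theorem IsGeneralizedJInduced.mvfderiv_eq_zero_of_isMixedGeodesic_distS (hJ : IsKaehler J)
    (hi : IsGeneralizedJInduced ET EP ES J φ θ)
    (hφ : IsBiwarpedSubmanifold ET EP ES E f σ φ) (hne : ∀ p : MT × MP × MS, distS ET EP ES p ≠ ⊥)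
    (hmixed : IsMixedGeodesic (E := E) (prodModel ET EP ES) φ (distT ET EP ES) (distS ET EP ES))
    (p : MT × MP × MS) : mvfderiv 𝓘(ℝ, ET) σ p.1 = 0 := by
  obtain ⟨a, ha, ha0⟩ := Submodule.exists_mem_ne_zero_of_ne_bot (hne p)
  ext w
  obtain ⟨t, ht, rfl⟩ := exists_mem_distT (EP := EP) (ES := ES) p w
  obtain ⟨u, hu, hJt⟩ := hi.exists_map_eq ht
  have hJu : J (φ p) (mfderiv (prodModel ET EP ES) 𝓘(ℝ, E) φ p u) =
      mfderiv (prodModel ET EP ES) 𝓘(ℝ, E) φ p (-t) := by rw [← hJt, hJ.sq, map_neg]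
  have hT : dprojT p a = 0 := ha.1
  have hP : dprojP p a = 0 := ha.2
  obtain ⟨c, hc, hac⟩ := hi.exists_tangential_eq hJ hφ hT
  have hσp := (hφ.σ_pos p.1).ne'
  -- The tangential part of `J a` is orthogonal to `a` because `⟨a, J a⟩ = 0`; since `a` has only an
  -- `MS`-component and `σ` is nonzero, this is orthogonality in `MS`. It removes the `dσ(u)` term
  -- from the formula.
  have hSc : inner ℝ (dprojS p a) (dprojS p c) = 0 := by
    have h1 := hφ.isometric p a c
    have h3 : mfderiv (prodModel ET EP ES) 𝓘(ℝ, E) φ p a ∈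
      tangentPlane (prodModel ET EP ES) φ p := ⟨a, rfl⟩
    rw [← hac, ← Submodule.inner_starProjection_left_eq_right,
      Submodule.starProjection_eq_self_iff.2 h3, hJ.inner_self] at h1
    simpa [biwarpedMetric, hT, hP, hσp] using h1
  have h := hi.inner_secondFundamentalForm hJ hφ hu (neg_mem ht) hJu hT hT hc hac
  rw [hmixed p u hu a ha, hP, hSc] at h
  have hS : dprojS p a ≠ 0 := fun h0 => ha0 (eq_zero_of_dproj_eq_zero p hT hP h0)
  simpa [hS, hσp] using h

end MixedGeodesic
end KaehlerSubmanifold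

/-! ### The equivalence. -/

theorem mainTheorem3
    -- the Kähler manifold `M`
    {E : Type*} [NormedAddCommGroup E] [NormedSpace ℝ E] [FiniteDimensional ℝ E]
    {M : Type*} [TopologicalSpace M] [ChartedSpace E M] [IsManifold 𝓘(ℝ, E) ∞ M]
    [RiemannianBundle (fun x : M => TangentSpace 𝓘(ℝ, E) x)]
    [IsContMDiffRiemannianBundle 𝓘(ℝ, E) ∞ E (fun x : M => TangentSpace 𝓘(ℝ, E) x)]
    (J : ∀ x : M, TangentSpace 𝓘(ℝ, E) x →L[ℝ] TangentSpace 𝓘(ℝ, E) x)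
    (hJ : KaehlerSubmanifold.IsKaehler J)
    -- the Riemannian manifolds `M_T`, `M_⊥`, `M_θ`
    {ET : Type*} [NormedAddCommGroup ET] [NormedSpace ℝ ET] [FiniteDimensional ℝ ET]
    {MT : Type*} [TopologicalSpace MT] [ConnectedSpace MT] [ChartedSpace ET MT]
    [IsManifold 𝓘(ℝ, ET) ∞ MT]
    [RiemannianBundle (fun x : MT => TangentSpace 𝓘(ℝ, ET) x)]
    [IsContMDiffRiemannianBundle 𝓘(ℝ, ET) ∞ ET (fun x : MT => TangentSpace 𝓘(ℝ, ET) x)]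
    {EP : Type*} [NormedAddCommGroup EP] [NormedSpace ℝ EP] [FiniteDimensional ℝ EP]
    {MP : Type*} [TopologicalSpace MP] [Nonempty MP] [ChartedSpace EP MP]
    [IsManifold 𝓘(ℝ, EP) ∞ MP]
    [RiemannianBundle (fun x : MP => TangentSpace 𝓘(ℝ, EP) x)]
    [IsContMDiffRiemannianBundle 𝓘(ℝ, EP) ∞ EP (fun x : MP => TangentSpace 𝓘(ℝ, EP) x)]
    {ES : Type*} [NormedAddCommGroup ES] [NormedSpace ℝ ES] [FiniteDimensional ℝ ES]
    {MS : Type*} [TopologicalSpace MS] [Nonempty MS] [ChartedSpace ES MS]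
    [IsManifold 𝓘(ℝ, ES) ∞ MS]
    [RiemannianBundle (fun x : MS => TangentSpace 𝓘(ℝ, ES) x)]
    [IsContMDiffRiemannianBundle 𝓘(ℝ, ES) ∞ ES (fun x : MS => TangentSpace 𝓘(ℝ, ES) x)]
    -- the warping functions, the immersion and the slant function
    (f σ : MT → ℝ) (φ : MT × MP × MS → M) (θ : MT × MP × MS → ℝ)
    (hφ : KaehlerSubmanifold.IsBiwarpedSubmanifold ET EP ES E f σ φ)
    (hinduced : KaehlerSubmanifold.IsGeneralizedJInduced ET EP ES J φ θ)
    (hproper : KaehlerSubmanifold.IsProper ET EP ES θ)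
    (hnormal : ∀ p, KaehlerSubmanifold.invariantNormal ET EP ES J φ p = ⊥) :
    ((∃ c, ∀ x, f x = c) ∧ (∃ c, ∀ x, σ x = c)) ↔
      (KaehlerSubmanifold.IsMixedGeodesic (E := E) (KaehlerSubmanifold.prodModel ET EP ES) φ
          (KaehlerSubmanifold.distT ET EP ES) (KaehlerSubmanifold.distP ET EP ES) ∧
        KaehlerSubmanifold.IsMixedGeodesic (E := E) (KaehlerSubmanifold.prodModel ET EP ES) φ
          (KaehlerSubmanifold.distT ET EP ES) (KaehlerSubmanifold.distS ET EP ES)) := by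

  constructor
  · rintro ⟨⟨c, hf⟩, ⟨d, hσ⟩⟩
    obtain rfl : f = fun _ => c := funext hf
    obtain rfl : σ = fun _ => d := funext hσ
    exact ⟨fun p u hu v hv => hinduced.secondFundamentalForm_eq_zero hJ hφ (hnormal p)
        (mvfderiv_const c) (mvfderiv_const d) hu hv.1,
      fun p u hu v hv => hinduced.secondFundamentalForm_eq_zero hJ hφ (hnormal p)
        (mvfderiv_const c) (mvfderiv_const d) hu hv.1⟩
  · rintro ⟨hP, hS⟩
    -- The differentials are controlled at first components of points of the product, so fixed
    -- points of `MP` and `MS` are needed to reach every `x` in `MT`.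
    obtain ⟨y⟩ := ‹Nonempty MP›
    obtain ⟨z⟩ := ‹Nonempty MS›
    exact ⟨KaehlerSubmanifold.exists_eq_const_of_mvfderiv_eq_zero
        (hφ.contMDiff_f.mdifferentiable (by simp)) fun x =>
          hinduced.mvfderiv_eq_zero_of_isMixedGeodesic_distP hJ hφ hproper.distP_ne hP (x, y, z),
      KaehlerSubmanifold.exists_eq_const_of_mvfderiv_eq_zero
        (hφ.contMDiff_σ.mdifferentiable (by simp)) fun x =>
          hinduced.mvfderiv_eq_zero_of_isMixedGeodesic_distS hJ hφ hproper.distS_ne hS (x, y, z)⟩
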